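/- Let $d\ge 1$ and let $G$ be the Coulomb kernel on $\mathbb R^d$: $G(x,y)=\frac{1}{(d-2)\|x-y\|^{d-2}}$ for $d\ge 3$, $G(x,y)=-\log\|x-y\|$ for $d=2$ (with $G=+\infty$ on the diagonal in both cases), and $G(x,y)=-|x-y|$ for $d=1$. A positive measure $\alpha$ has finite energy if $\iint |G|\,d\alpha\,d\alpha<\infty$. Let $\nu$ be a probability measure of finite energy, and for a probability measure $\mu$ of finite energy put $E_\nu(\mu)=\frac12\iint G\,d(\mu-\nu)\,d(\mu-\nu)$. Let $K_t(x)=(4\pi t)^{-d/2}e^{-\|x\|^2/(4t)}$ for $t>0$ be the heat kernel, with the convention $K_0\star\rho=\rho$, and let $W_2$ be the $2$-Wasserstein distance (the infimum over couplings, possibly $+\infty$ outside the measures with finite second moment). **Theorem.** Let $\mu\neq\nu$ be a probability measure of finite energy, and let $\mu-\nu=\mu_+-\nu_-$ be the Hahn–Jordan decomposition. Then there is a Borel set $A$ with $\mu_+(A)\ge \mu_+(\mathbb R^d)/2$ such that the curve $$\mu_t=\mu+K_t\star\mu_{+|A}-\mu_{+|A},\qquad t\ge 0,$$ which starts at $\mu_0=\mu$,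 has the following properties. 1. Each $\mu_t$ is a probability measure; it has finite energy, as does $|\mu_t-\nu|$; and it has finite second moment if $\mu$ does. 2. The curve is $1/2$-Hölder for $W_2$: there is a constant $C$ with $W_2(\mu_s,\mu_t)\le C\sqrt{|s-t|}$ for all $s,t\ge0$. 3. There is $t_0>0$ such that $t\mapsto E_\nu(\mu_t)$ is differentiable with $\frac{d}{dt}E_\nu(\mu_t)<0$ for all $0<t<t_0$, and $t\mapsto E_\nu(\mu_t)$ is strictly decreasing on $[0,t_0)$. Consequently $E_\nu$ has no local minimum for $W_2$ other than $\nu$: if $\mu$ is a probability measure of finite energy and there is $\varepsilon>0$ such that $E_\nu(\mu)\le E_\nu(\mu')$ for every probability measure $\mu'$ of finite energy with $W_2(\mu',\mu)<\varepsilon$, then $\mu=\nu$. -/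

import Mathlib

open MeasureTheory Set
open scoped ENNReal NNReal

noncomputable section

namespace CoulombMMD

/-- The Euclidean space `ℝ^d`. -/
abbrev Space (d : ℕ) : Type := EuclideanSpace ℝ (Fin d)

/-- The Riesz kernel `k_s(x, y) = 1 / (s ‖x - y‖ ^ s)` for `s ≠ 0`, and
`k_0(x, y) = - log ‖x - y‖`. For `s ≥ 0` it takes the value `+∞` on the diagonal. -/
def rieszKernel (d : ℕ) (s : ℝ) (x y : Space d) : EReal :=
  if x = y ∧ 0 ≤ s then ⊤
  else if s = 0 then ((-Real.log ‖x - y‖ : ℝ) : EReal)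
  else ((‖x - y‖ ^ (-s) / s : ℝ) : EReal)

/-- The Coulomb kernel of `ℝ^d`: the Riesz kernel of exponent `s = d - 2`. So it is
`1 / ((d - 2) ‖x - y‖ ^ (d - 2))` for `d ≥ 3`, `- log ‖x - y‖` for `d = 2`, and
`- |x - y|` for `d = 1`. -/
def coulombKernel (d : ℕ) : Space d → Space d → EReal :=
  rieszKernel d ((d : ℝ) - 2)

variable {X : Type*} [MeasurableSpace X]

/-- The positive measure `α` has finite internal `G`-energy: `∬ |G| dα dα < ∞`. -/
def HasFiniteEnergy (G : X → X → EReal) (α : Measure X) : Prop :=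
  ∫⁻ p : X × X, (G p.1 p.2).abs ∂(α.prod α) < ∞

/-- The mutual energy `∬ G dα dβ` of two positive measures. -/
def mutualEnergy (G : X → X → EReal) (α β : Measure X) : ℝ :=
  ∫ p : X × X, (G p.1 p.2).toReal ∂(α.prod β)

/-- The internal energy `E(ρ) = (1/2) ∬ G dρ dρ` of a signed measure `ρ`, where the integral
against `ρ ⊗ ρ` is expanded along the Jordan decomposition of `ρ`. -/
def energy (G : X → X → EReal) (ρ : SignedMeasure X) : ℝ :=
  (mutualEnergy G ρ.toJordanDecomposition.posPart ρ.toJordanDecomposition.posPart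
    - mutualEnergy G ρ.toJordanDecomposition.posPart ρ.toJordanDecomposition.negPart
    - mutualEnergy G ρ.toJordanDecomposition.negPart ρ.toJordanDecomposition.posPart
    + mutualEnergy G ρ.toJordanDecomposition.negPart ρ.toJordanDecomposition.negPart) / 2

/-- The signed measure `μ - ν`. -/
def signedDiff (μ ν : ProbabilityMeasure X) : SignedMeasure X :=
  (μ : Measure X).toSignedMeasure - (ν : Measure X).toSignedMeasure

/-- The functional `E_ν(μ) = E(μ - ν)`. -/
def discrepancy (G : X → X → EReal) (ν μ : ProbabilityMeasure X) : ℝ :=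
  energy G (signedDiff μ ν)

/-- The positive component `μ₊` of the Hahn-Jordan decomposition `μ - ν = μ₊ - ν₋`. -/
def posComponent (μ ν : ProbabilityMeasure X) : Measure X :=
  (signedDiff μ ν).toJordanDecomposition.posPart

/-- The `2`-Wasserstein distance, with values in `[0, ∞]`; it is finite on measures with finite
second moment. -/
def W₂ {Y : Type*} [MeasurableSpace Y] [PseudoEMetricSpace Y] (μ ν : Measure Y) : ℝ≥0∞ :=
  (⨅ γ ∈ {γ : Measure (Y × Y) | γ.map Prod.fst = μ ∧ γ.map Prod.snd = ν},
    ∫⁻ p, edist p.1 p.2 ^ 2 ∂γ) ^ (1 / 2 : ℝ)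

/-- The measure `μ` has finite second moment. -/
def HasFiniteSecondMoment {d : ℕ} (μ : Measure (Space d)) : Prop :=
  ∫⁻ x, ‖x‖ₑ ^ 2 ∂μ < ∞

/-- `μ` (in the domain of finite energy measures) is a local minimum of `E_ν` for the
Wasserstein distance. -/
def IsWassersteinLocalMin (d : ℕ) (ν μ : ProbabilityMeasure (Space d)) : Prop :=
  HasFiniteEnergy (coulombKernel d) (μ : Measure (Space d)) ∧
    ∃ ε : ℝ≥0∞, 0 < ε ∧ ∀ μ' : ProbabilityMeasure (Space d),
      HasFiniteEnergy (coulombKernel d) (μ' : Measure (Space d)) →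
      W₂ (μ' : Measure (Space d)) (μ : Measure (Space d)) < ε →
      discrepancy (coulombKernel d) ν μ ≤ discrepancy (coulombKernel d) ν μ'

/-- The heat kernel `K_t(x) = (4πt)^{-d/2} exp(-‖x‖² / (4t))`. -/
def heatKernel (d : ℕ) (t : ℝ) (x : Space d) : ℝ :=
  1 / (4 * Real.pi * t) ^ ((d : ℝ) / 2) * Real.exp (-‖x‖ ^ 2 / (4 * t))

/-- The measure `K_t ⋆ ρ`, the solution at time `t` of the heat equation `∂ₜ ρₜ = Δ ρₜ` with
initial condition `ρ`; it is `ρ` itself at `t = 0`. -/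
def heatFlow {d : ℕ} (t : ℝ) (ρ : Measure (Space d)) : Measure (Space d) :=
  if t = 0 then ρ
  else ((volume : Measure (Space d)).withDensity
    (fun x => ENNReal.ofReal (heatKernel d t x))).conv ρ

/-- The curve `c` is `1/2`-Hölder on `[0, ∞)` for the Wasserstein distance. -/
def IsHalfHolder {d : ℕ} (c : ℝ → ProbabilityMeasure (Space d)) : Prop :=
  ∃ C : ℝ≥0, ∀ s t : ℝ, 0 ≤ s → 0 ≤ t →
    W₂ (c s : Measure (Space d)) (c t : Measure (Space d)) ≤
      C * ENNReal.ofReal (Real.sqrt |s - t|)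

end CoulombMMD

end

noncomputable section

namespace CoulombMMD

/-! The Coulomb kernel is the time integral of the heat kernel: with c = `sphereConst d`, c (G(r) -
G(1)) = ∫₀^∞ (K_s(r) - K_s(1)) ds, the base point 1 making the integral converge in every dimension.
Put H(α, β; s) = ∬ K_s(x - y) dα dβ (`heatForm`). Integrating in x and y writes c ∬ G dα dβ as a
constant depending only on the masses plus a renormalised integral of H over s > 0
(`IsTame.mutualEnergy_eq`). By the semigroup law, replacing α by K_t ⋆ α shifts s to s + t and keeps
the mass, so the mutual energy drops by exactly c⁻¹ ∫₀^t H(α, β; s) ds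
(`IsTame.mutualEnergy_heatFlow`).

Let p, n be the Jordan parts of μ - ν, α = p|A and b = μ - α. Along b + K_t ⋆ α the energy has
derivative -c⁻¹ D(t), with D(t) = H(α, p; t) - H(α, n; t) - H(α, α; t) + H(α, α; 2t). Since α ≤ p,
the first term beats the third. Since n ⟂ p, differentiation of measures gives a set A carrying half
of p around whose points small balls satisfy n(B) ≤ ε p(B) (`exists_ball_domination`). The kernel
K_t is a superposition of balls, so H(α, n; t) ≤ ε H(α, p; t) up to an exponentially small tail
(`lintegral_heatKernel_le`). What must be paid, ε H(α, α; t) and the tail, is absorbed by H(α, α;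
2t), because K_t ≤ 2^{d/2} K_{2t}. Hence D > 0 for small t (`exists_dissipation`).

The kernel is not of one sign when d ≤ 2, so finite energy is first translated into conditions
stable under sums, submeasures and the flow (`IsTame`). For W₂, the same Gaussian variable drives
the diffusion at all times, which gives a coupling of cost at most a constant times |s - t|. The
curve thus starts at μ, is continuous there and strictly lowers the energy, so μ ≠ ν is not a local
minimum. -/

/-- The radial profile of the heat kernel. -/
def gaussProfile (d : ℕ) (s r : ℝ) : ℝ :=
  1 / (4 * Real.pi * s) ^ ((d : ℝ) / 2) * Real.exp (-r ^ 2 / (4 * s))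

/-- The radial profile of the Coulomb kernel, with the value `0` at the pole. -/
def coulombProfile (d : ℕ) (r : ℝ) : ℝ :=
  if (d : ℝ) - 2 = 0 then -Real.log r else r ^ (-((d : ℝ) - 2)) / ((d : ℝ) - 2)

/-- The constant `c` such that `-Δ G = c⁻¹ δ₀`. -/
def sphereConst (d : ℕ) : ℝ :=
  Real.Gamma ((d : ℝ) / 2) / (2 * Real.pi ^ ((d : ℝ) / 2))

/-! ### Radial calculus: the Coulomb profile as a time integral of heat profiles. -/

lemma sphereConst_pos {d : ℕ} (hd : 1 ≤ d) : 0 < sphereConst d := by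
  have : (0 : ℝ) < d / 2 := by positivity
  unfold sphereConst
  have := Real.Gamma_pos_of_pos this
  positivity

lemma gaussProfile_pos (d : ℕ) {s : ℝ} (hs : 0 < s) (r : ℝ) : 0 < gaussProfile d s r := by
  unfold gaussProfile; positivity

lemma gaussProfile_anti (d : ℕ) {s : ℝ} (hs : 0 < s) {a b : ℝ} (ha : 0 ≤ a) (hab : a ≤ b) :
    gaussProfile d s b ≤ gaussProfile d s a := by
  unfold gaussProfile; gcongr

lemma gaussProfile_le (d : ℕ) {s : ℝ} (hs : 0 < s) (r : ℝ) :
    gaussProfile d s r ≤ 1 / (4 * Real.pi * s) ^ ((d : ℝ) / 2) := by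
  unfold gaussProfile
  apply mul_le_of_le_one_right (by positivity)
  rw [Real.exp_le_one_iff, neg_div]
  have : 0 ≤ r ^ 2 / (4 * s) := by positivity
  linarith

lemma measurable_gaussProfile (d : ℕ) :
    Measurable (fun p : ℝ × ℝ => gaussProfile d p.1 p.2) := by
  unfold gaussProfile; fun_prop

/-- The substitution y = 1/s turns this into a Gamma integral. The integrand is minus the radial
derivative of the heat profile; differentiating first gives convergence for d ≤ 2, where ∫ K_s ds
diverges at infinity. -/
lemma integral_radial_deriv {d : ℕ} (hd : 1 ≤ d) {ρ : ℝ} (hρ : 0 < ρ) :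
    ∫ s in Ioi (0 : ℝ), ρ / (2 * s) * gaussProfile d s ρ = sphereConst d * ρ ^ (1 - (d : ℝ)) := by
  have hd2 : (0 : ℝ) < d / 2 := by positivity
  have h1 := integral_comp_rpow_Ioi (fun y : ℝ => y ^ ((d : ℝ) / 2 - 1) * Real.exp (-(ρ ^ 2 / 4 * y)))
    (p := -1) (by norm_num)
  rw [Real.integral_rpow_mul_exp_neg_mul_Ioi hd2 (by positivity)] at h1
  have h2 : ∀ s ∈ Ioi (0 : ℝ), ρ / (2 * s) * gaussProfile d s ρ =
      (ρ / (2 * (4 * Real.pi) ^ ((d : ℝ) / 2))) * ((|(-1 : ℝ)| * s ^ ((-1 : ℝ) - 1)) •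
        ((s ^ (-1 : ℝ)) ^ ((d : ℝ) / 2 - 1) * Real.exp (-(ρ ^ 2 / 4 * s ^ (-1 : ℝ))))) := by
    intro s hs
    have hs : 0 < s := hs
    have e1 : (s ^ (-1 : ℝ)) ^ ((d : ℝ) / 2 - 1) = s * (s ^ ((d : ℝ) / 2))⁻¹ := by
      rw [← Real.rpow_mul hs.le, show (-1 : ℝ) * (d / 2 - 1) = 1 + -(d / 2) by ring,
        Real.rpow_add hs, Real.rpow_neg hs.le, Real.rpow_one]
    have e2 : s ^ ((-1 : ℝ) - 1) = (s ^ 2)⁻¹ := by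
      rw [show (-1 : ℝ) - 1 = -(2 : ℕ) by norm_num, Real.rpow_neg hs.le, Real.rpow_natCast]
    rw [e1, e2, Real.rpow_neg_one, gaussProfile, Real.mul_rpow (by positivity) hs.le]
    have e3 : -ρ ^ 2 / (4 * s) = -(ρ ^ 2 / 4 * s⁻¹) := by field_simp
    rw [e3, smul_eq_mul, abs_neg, abs_one]
    field_simp
  rw [setIntegral_congr_fun measurableSet_Ioi h2, integral_const_mul, h1, sphereConst]
  have e4 : (1 / (ρ ^ 2 / 4)) ^ ((d : ℝ) / 2) = 4 ^ ((d : ℝ) / 2) * (ρ ^ (d : ℝ))⁻¹ := by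
    rw [show 1 / (ρ ^ 2 / 4) = 4 * (ρ ^ 2)⁻¹ by field_simp, Real.mul_rpow (by norm_num) (by positivity),
      Real.inv_rpow (by positivity), ← Real.rpow_natCast, ← Real.rpow_mul hρ.le]
    congr 3
    push_cast; ring
  rw [e4, Real.mul_rpow (by norm_num) Real.pi_pos.le, Real.rpow_sub hρ, Real.rpow_one]
  field_simp

lemma lintegral_radial_deriv {d : ℕ} (hd : 1 ≤ d) {ρ : ℝ} (hρ : 0 < ρ) :
    ∫⁻ s in Ioi (0 : ℝ), ENNReal.ofReal (ρ / (2 * s) * gaussProfile d s ρ) =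
      ENNReal.ofReal (sphereConst d * ρ ^ (1 - (d : ℝ))) := by
  rw [← integral_radial_deriv hd hρ, ofReal_integral_eq_lintegral_ofReal]
  -- A non-integrable function has Bochner integral 0 by convention, so a nonzero value proves
  -- integrability.
  · apply Integrable.of_integral_ne_zero
    rw [integral_radial_deriv hd hρ]
    have := sphereConst_pos hd
    positivity
  · refine (ae_restrict_iff' measurableSet_Ioi).2 (ae_of_all _ fun s hs => ?_)
    have hs : 0 < s := hs
    have := gaussProfile_pos d hs ρ
    show 0 ≤ ρ / (2 * s) * gaussProfile d s ρ
    positivity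

lemma hasDerivAt_gaussProfile (d : ℕ) (s r : ℝ) :
    HasDerivAt (fun r => gaussProfile d s r) (-(r / (2 * s) * gaussProfile d s r)) r := by
  unfold gaussProfile
  have h : HasDerivAt (fun r : ℝ => -r ^ 2 / (4 * s)) (-(r / (2 * s))) r := by
    refine (((hasDerivAt_pow 2 r).fun_neg).div_const (4 * s)).congr_deriv ?_
    rcases eq_or_ne s 0 with rfl | hs
    · simp
    · push_cast; field_simp; norm_num; ring
  refine ((h.exp).const_mul _).congr_deriv ?_
  ring

lemma lintegral_radial_Ioc (d : ℕ) {s a b : ℝ} (hs : 0 < s) (ha : 0 ≤ a) (hab : a ≤ b) :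
    ∫⁻ ρ in Ioc a b, ENNReal.ofReal (ρ / (2 * s) * gaussProfile d s ρ) =
      ENNReal.ofReal (gaussProfile d s a - gaussProfile d s b) := by
  have hc : Continuous fun ρ => ρ / (2 * s) * gaussProfile d s ρ := by
    unfold gaussProfile; fun_prop
  have h := intervalIntegral.integral_eq_sub_of_hasDerivAt (a := a) (b := b)
    (f := fun r => -gaussProfile d s r) (f' := fun ρ => ρ / (2 * s) * gaussProfile d s ρ)
    (fun r _ => ((hasDerivAt_gaussProfile d s r).fun_neg).congr_deriv (neg_neg _))
    (hc.intervalIntegrable _ _)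
  rw [intervalIntegral.integral_of_le hab] at h
  rw [← ofReal_integral_eq_lintegral_ofReal, h]
  · congr 1; ring
  · exact (hc.integrableOn_Icc).mono_set Ioc_subset_Icc_self
  · refine (ae_restrict_iff' measurableSet_Ioc).2 (ae_of_all _ fun ρ hρ => ?_)
    have : 0 ≤ ρ := ha.trans hρ.1.le
    have := gaussProfile_pos d hs ρ
    show 0 ≤ ρ / (2 * s) * gaussProfile d s ρ
    positivity

/-- The hypothesis on `a` keeps away from the pole. On the line there is none, and a = 0 must be
allowed because measures of finite energy may then have atoms. -/
lemma lintegral_rpow_Ioc {d : ℕ} (hd : 1 ≤ d) {a b : ℝ} (ha : 0 < a ∨ d = 1 ∧ 0 ≤ a) (hab : a ≤ b) :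
    ∫⁻ ρ in Ioc a b, ENNReal.ofReal (ρ ^ (1 - (d : ℝ))) =
      ENNReal.ofReal (coulombProfile d a - coulombProfile d b) := by
  have ha0 : 0 ≤ a := by rcases ha with h | h; exacts [h.le, h.2]
  have hI : IntervalIntegrable (fun ρ : ℝ => ρ ^ (1 - (d : ℝ))) volume a b := by
    rcases ha with h | ⟨rfl, h⟩
    · apply intervalIntegral.intervalIntegrable_rpow
      right
      rw [uIcc_of_le hab]
      exact fun h' => absurd h'.1 (not_le.2 h)
    · apply intervalIntegral.intervalIntegrable_rpow'; norm_num
  rw [← ofReal_integral_eq_lintegral_ofReal]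
  · rw [← intervalIntegral.integral_of_le hab]
    congr 1
    unfold coulombProfile
    split_ifs with h2
    · have hd2 : (d : ℝ) = 2 := by linarith
      have ha' : 0 < a := by
        rcases ha with h | h
        · exact h
        · rw [h.1] at hd2; norm_num at hd2
      rw [hd2, show (1 : ℝ) - 2 = -1 by norm_num]
      simp_rw [Real.rpow_neg_one]
      rw [integral_inv_of_pos ha' (ha'.trans_le hab), Real.log_div (by linarith) ha'.ne']
      ring
    · rw [integral_rpow]
      · have : (1 - (d : ℝ) + 1) = -((d : ℝ) - 2) := by ring
        rw [this, div_neg]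
        field_simp
        ring
      · rcases ha with h | ⟨rfl, h⟩
        · right
          refine ⟨fun h' => h2 (by linarith), ?_⟩
          rw [uIcc_of_le hab]
          exact fun h' => absurd h'.1 (not_le.2 h)
        · left; norm_num
  · exact (intervalIntegrable_iff_integrableOn_Ioc_of_le hab).1 hI
  · refine (ae_restrict_iff' measurableSet_Ioc).2 (ae_of_all _ fun ρ hρ => ?_)
    have : 0 ≤ ρ := ha0.trans hρ.1.le
    show 0 ≤ ρ ^ (1 - (d : ℝ))
    positivity

lemma coulombProfile_anti {d : ℕ} {a b : ℝ} (ha : 0 < a ∨ d = 1 ∧ 0 ≤ a)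
    (hab : a ≤ b) : coulombProfile d b ≤ coulombProfile d a := by
  unfold coulombProfile
  rcases ha with h | ⟨rfl, h⟩
  · split_ifs with h2
    · exact neg_le_neg (Real.log_le_log h hab)
    · rcases lt_or_gt_of_ne h2 with h3 | h3
      · rw [div_le_div_right_of_neg h3]
        apply Real.rpow_le_rpow h.le hab; linarith
      · rw [div_le_div_iff_of_pos_right h3]
        apply Real.rpow_le_rpow_of_nonpos h hab; linarith
  · norm_num [div_neg]; exact hab

/-- Tonelli: the difference of profiles is the integral over (a, b] of the radial derivative, whose
time integral is c ρ^{1-d}, minus the derivative of c times the Coulomb profile. -/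
lemma lintegral_gaussProfile_sub {d : ℕ} (hd : 1 ≤ d) {a b : ℝ} (ha : 0 < a ∨ d = 1 ∧ 0 ≤ a)
    (hab : a ≤ b) :
    ∫⁻ s in Ioi (0 : ℝ), ENNReal.ofReal (gaussProfile d s a - gaussProfile d s b) =
      ENNReal.ofReal (sphereConst d * (coulombProfile d a - coulombProfile d b)) := by
  have ha0 : 0 ≤ a := by rcases ha with h | h; exacts [h.le, h.2]
  have h1 : ∀ s ∈ Ioi (0 : ℝ), ENNReal.ofReal (gaussProfile d s a - gaussProfile d s b) =
      ∫⁻ ρ in Ioc a b, ENNReal.ofReal (ρ / (2 * s) * gaussProfile d s ρ) := fun s hs =>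
    (lintegral_radial_Ioc d hs ha0 hab).symm
  rw [setLIntegral_congr_fun measurableSet_Ioi h1, lintegral_lintegral_swap]
  · have h2 : ∀ ρ ∈ Ioc a b, ∫⁻ s in Ioi (0 : ℝ), ENNReal.ofReal (ρ / (2 * s) * gaussProfile d s ρ) =
      ENNReal.ofReal (sphereConst d) * ENNReal.ofReal (ρ ^ (1 - (d : ℝ))) := fun ρ hρ => by
      rw [lintegral_radial_deriv hd (ha0.trans_lt hρ.1), ENNReal.ofReal_mul (sphereConst_pos hd).le]
    rw [setLIntegral_congr_fun measurableSet_Ioc h2, lintegral_const_mul _ (by fun_prop),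
      lintegral_rpow_Ioc hd ha hab, ENNReal.ofReal_mul (sphereConst_pos hd).le]
  · apply Measurable.aemeasurable
    have := measurable_gaussProfile d
    unfold Function.uncurry
    fun_prop

lemma measurable_gaussProfile_time (d : ℕ) (r : ℝ) : Measurable fun s => gaussProfile d s r := by
  unfold gaussProfile; fun_prop

/-- The radial form of `G(x) - G(e) = c ∫₀^∞ (K_s(x) - K_s(e)) ds`, with absolute convergence. -/
lemma integral_gaussProfile_sub_of_le {d : ℕ} (hd : 1 ≤ d) {a b : ℝ} (ha : 0 < a ∨ d = 1 ∧ 0 ≤ a)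
    (hab : a ≤ b) :
    IntegrableOn (fun s => gaussProfile d s a - gaussProfile d s b) (Ioi 0) ∧
    ∫ s in Ioi (0 : ℝ), (gaussProfile d s a - gaussProfile d s b) =
      sphereConst d * (coulombProfile d a - coulombProfile d b) := by
  have ha0 : 0 ≤ a := by rcases ha with h | h; exacts [h.le, h.2]
  have hnn : 0 ≤ᵐ[volume.restrict (Ioi (0 : ℝ))]
      (fun s => gaussProfile d s a - gaussProfile d s b) := by
    refine (ae_restrict_iff' measurableSet_Ioi).2 (ae_of_all _ fun s hs => ?_)
    exact sub_nonneg.2 (gaussProfile_anti d hs ha0 hab)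
  have hm : Measurable (fun s => gaussProfile d s a - gaussProfile d s b) :=
    (measurable_gaussProfile_time d a).sub (measurable_gaussProfile_time d b)
  constructor
  · refine ⟨hm.aestronglyMeasurable, ?_⟩
    rw [hasFiniteIntegral_iff_ofReal hnn, lintegral_gaussProfile_sub hd ha hab]
    exact ENNReal.ofReal_lt_top
  · rw [integral_eq_lintegral_of_nonneg_ae hnn hm.aestronglyMeasurable,
      lintegral_gaussProfile_sub hd ha hab, ENNReal.toReal_ofReal]
    exact mul_nonneg (sphereConst_pos hd).le (sub_nonneg.2 (coulombProfile_anti ha hab))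

lemma integral_gaussProfile_sub {d : ℕ} (hd : 1 ≤ d) {r : ℝ} (hr : 0 < r ∨ d = 1 ∧ 0 ≤ r) :
    IntegrableOn (fun s => gaussProfile d s r - gaussProfile d s 1) (Ioi 0) ∧
    ∫ s in Ioi (0 : ℝ), (gaussProfile d s r - gaussProfile d s 1) =
      sphereConst d * (coulombProfile d r - coulombProfile d 1) := by
  rcases le_total r 1 with h | h
  · exact integral_gaussProfile_sub_of_le hd hr h
  · obtain ⟨h1, h2⟩ := integral_gaussProfile_sub_of_le hd (a := 1) (Or.inl one_pos) h
    constructor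
    · refine h1.neg.congr (ae_of_all _ fun s => ?_)
      simp
    · rw [← neg_inj, ← integral_neg]
      simp only [neg_sub, h2]; ring

lemma lintegral_abs_gaussProfile_sub {d : ℕ} (hd : 1 ≤ d) {r : ℝ} (hr : 0 < r ∨ d = 1 ∧ 0 ≤ r) :
    ∫⁻ s in Ioi (0 : ℝ), ENNReal.ofReal |gaussProfile d s r - gaussProfile d s 1| =
      ENNReal.ofReal (sphereConst d * |coulombProfile d r - coulombProfile d 1|) := by
  have hr0 : 0 ≤ r := by rcases hr with h | h; exacts [h.le, h.2]
  rcases le_total r 1 with h | h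
  · rw [abs_of_nonneg (sub_nonneg.2 (coulombProfile_anti hr h)), ← lintegral_gaussProfile_sub hd hr h]
    refine setLIntegral_congr_fun measurableSet_Ioi fun s hs => ?_
    rw [abs_of_nonneg (sub_nonneg.2 (gaussProfile_anti d hs hr0 h))]
  · have h1 : 0 < (1 : ℝ) ∨ d = 1 ∧ 0 ≤ (1 : ℝ) := Or.inl one_pos
    rw [abs_sub_comm, abs_of_nonneg (sub_nonneg.2 (coulombProfile_anti h1 h)),
      ← lintegral_gaussProfile_sub hd h1 h]
    refine setLIntegral_congr_fun measurableSet_Ioi fun s hs => ?_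
    rw [abs_sub_comm, abs_of_nonneg (sub_nonneg.2 (gaussProfile_anti d hs zero_le_one h))]

/-! ### The heat kernel on space: semigroup law, scaling, moments and the flow. -/

lemma heatKernel_eq (d : ℕ) (s : ℝ) (x : Space d) : heatKernel d s x = gaussProfile d s ‖x‖ := rfl

lemma heatKernel_pos {d : ℕ} {s : ℝ} (hs : 0 < s) (x : Space d) : 0 < heatKernel d s x :=
  gaussProfile_pos d hs _

lemma continuous_heatKernel (d : ℕ) (s : ℝ) : Continuous (heatKernel d s) := by
  unfold heatKernel; fun_prop

lemma measurable_heatKernel (d : ℕ) :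
    Measurable (fun p : ℝ × Space d => heatKernel d p.1 p.2) := by
  unfold heatKernel; fun_prop

lemma heatKernel_neg (d : ℕ) (s : ℝ) (x : Space d) : heatKernel d s (-x) = heatKernel d s x := by
  simp [heatKernel]

lemma heatKernel_sub_comm (d : ℕ) (s : ℝ) (x y : Space d) :
    heatKernel d s (x - y) = heatKernel d s (y - x) := by
  rw [← heatKernel_neg, neg_sub]

lemma integral_exp_quadratic {d : ℕ} {b : ℝ} (hb : 0 < b) (v : Space d) :
    ∫ z : Space d, Real.exp (-b * ‖z‖ ^ 2 + inner ℝ v z) =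
      (Real.pi / b) ^ ((d : ℝ) / 2) * Real.exp (‖v‖ ^ 2 / (4 * b)) := by
  have h := GaussianFourier.integral_cexp_neg_mul_sq_norm_add (b := (b : ℂ)) (V := Space d)
    (by simpa using hb) 1 v
  rw [finrank_euclideanSpace_fin] at h
  apply Complex.ofReal_injective
  rw [← integral_complex_ofReal]
  push_cast
  rw [Complex.ofReal_cpow (by positivity)]
  push_cast
  simpa using h

/-- The semigroup law: expanding ‖w + z‖² leaves a single Gaussian integral with a linear term. -/
lemma integral_heatKernel_mul {d : ℕ} {s t : ℝ} (hs : 0 < s) (ht : 0 < t) (w : Space d) :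
    ∫ z, heatKernel d s (w + z) * heatKernel d t z = heatKernel d (s + t) w := by
  have hb : 0 < 1 / (4 * s) + 1 / (4 * t) := by positivity
  have h1 : ∀ z : Space d, heatKernel d s (w + z) * heatKernel d t z =
      (1 / (4 * Real.pi * s) ^ ((d : ℝ) / 2) * (1 / (4 * Real.pi * t) ^ ((d : ℝ) / 2)) *
        Real.exp (-‖w‖ ^ 2 / (4 * s))) *
      Real.exp (-(1 / (4 * s) + 1 / (4 * t)) * ‖z‖ ^ 2 + inner ℝ ((-(1 / (2 * s))) • w) z) := by
    intro z
    unfold heatKernel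
    have : -‖w + z‖ ^ 2 / (4 * s) + -‖z‖ ^ 2 / (4 * t) = -‖w‖ ^ 2 / (4 * s) +
        (-(1 / (4 * s) + 1 / (4 * t)) * ‖z‖ ^ 2 + inner ℝ ((-(1 / (2 * s))) • w) z) := by
      rw [norm_add_sq_real, real_inner_smul_left]
      field_simp
      ring
    rw [mul_mul_mul_comm, ← Real.exp_add, this, Real.exp_add]
    ring
  simp_rw [h1]
  rw [integral_const_mul, integral_exp_quadratic hb, norm_smul, heatKernel]
  have e1 : (‖-(1 / (2 * s))‖ * ‖w‖) ^ 2 / (4 * (1 / (4 * s) + 1 / (4 * t))) =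
      ‖w‖ ^ 2 * t / (4 * s * (s + t)) := by
    rw [norm_neg, Real.norm_of_nonneg (by positivity)]
    field_simp
    ring
  have e2 : Real.pi / (1 / (4 * s) + 1 / (4 * t)) =
      (4 * Real.pi * s) * (4 * Real.pi * t) / (4 * Real.pi * (s + t)) := by
    field_simp
    ring
  rw [e1, e2, Real.div_rpow (by positivity) (by positivity),
    Real.mul_rpow (x := 4 * Real.pi * s) (y := 4 * Real.pi * t) (by positivity) (by positivity)]
  have p1 : 0 < (4 * Real.pi * s) ^ ((d : ℝ) / 2) := by positivity
  have p2 : 0 < (4 * Real.pi * t) ^ ((d : ℝ) / 2) := by positivity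
  have e3 : -‖w‖ ^ 2 / (4 * (s + t)) = -‖w‖ ^ 2 / (4 * s) + ‖w‖ ^ 2 * t / (4 * s * (s + t)) := by
    field_simp
    ring
  rw [e3, Real.exp_add]
  generalize (4 * Real.pi * s) ^ ((d : ℝ) / 2) = a at *
  generalize (4 * Real.pi * t) ^ ((d : ℝ) / 2) = b at *
  field_simp

lemma integral_heatKernel {d : ℕ} {t : ℝ} (ht : 0 < t) : ∫ z : Space d, heatKernel d t z = 1 := by
  have h := integral_exp_quadratic (d := d) (b := 1 / (4 * t)) (by positivity) 0
  unfold heatKernel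
  rw [integral_const_mul]
  have : ∀ z : Space d, -‖z‖ ^ 2 / (4 * t) = -(1 / (4 * t)) * ‖z‖ ^ 2 + inner ℝ (0 : Space d) z := by
    intro z; simp; ring
  simp_rw [this, h]
  have : Real.pi / (1 / (4 * t)) = 4 * Real.pi * t := by field_simp
  rw [this]
  simp
  field_simp

/-- The Gaussian measure with density `K_t`. -/
def heatMeasure (d : ℕ) (t : ℝ) : Measure (Space d) :=
  (volume : Measure (Space d)).withDensity (fun x => ENNReal.ofReal (heatKernel d t x))

lemma lintegral_heatMeasure {d : ℕ} {t : ℝ} {f : Space d → ℝ≥0∞} (hf : Measurable f) :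
    ∫⁻ z, f z ∂heatMeasure d t = ∫⁻ z, ENNReal.ofReal (heatKernel d t z) * f z := by
  rw [heatMeasure, lintegral_withDensity_eq_lintegral_mul _ _ hf]
  · rfl
  · exact (continuous_heatKernel d t).measurable.ennreal_ofReal

lemma lintegral_heatKernel_add {d : ℕ} {s t : ℝ} (hs : 0 < s) (ht : 0 < t) (w : Space d) :
    ∫⁻ z, ENNReal.ofReal (heatKernel d s (w + z)) ∂heatMeasure d t =
      ENNReal.ofReal (heatKernel d (s + t) w) := by
  have hc := continuous_heatKernel d s
  rw [lintegral_heatMeasure (by fun_prop), ← integral_heatKernel_mul hs ht,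
    ofReal_integral_eq_lintegral_ofReal]
  · refine lintegral_congr fun z => ?_
    rw [mul_comm, ENNReal.ofReal_mul (heatKernel_pos hs _).le]
  · apply Integrable.of_integral_ne_zero
    rw [integral_heatKernel_mul hs ht]
    exact (heatKernel_pos (by positivity) _).ne'
  · exact ae_of_all _ fun z => mul_nonneg (heatKernel_pos hs _).le (heatKernel_pos ht _).le

lemma isProbabilityMeasure_heatMeasure {d : ℕ} {t : ℝ} (ht : 0 < t) :
    IsProbabilityMeasure (heatMeasure d t) := by
  constructor
  rw [← lintegral_one, lintegral_heatMeasure measurable_const]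
  simp only [mul_one]
  rw [← ofReal_integral_eq_lintegral_ofReal, integral_heatKernel ht, ENNReal.ofReal_one]
  · apply Integrable.of_integral_ne_zero
    rw [integral_heatKernel ht]
    exact one_ne_zero
  · exact ae_of_all _ fun z => (heatKernel_pos ht _).le

instance (d : ℕ) : IsProbabilityMeasure (heatMeasure d 1) :=
  isProbabilityMeasure_heatMeasure one_pos

/-- Parabolic scaling. It realises K_t ⋆ ρ at all times as the law of √t Z + X with one and the same
Z, which is what couples different times. -/
lemma heatMeasure_eq_map {d : ℕ} {t : ℝ} (ht : 0 < t) :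
    heatMeasure d t = (heatMeasure d 1).map (fun z => Real.sqrt t • z) := by
  refine Measure.ext_of_lintegral _ fun f hf => ?_
  have hst : 0 < Real.sqrt t := Real.sqrt_pos.2 ht
  rw [lintegral_map hf (by fun_prop), lintegral_heatMeasure hf, lintegral_heatMeasure (by fun_prop)]
  have h1 : ∀ z : Space d, ENNReal.ofReal (heatKernel d 1 z) * f (Real.sqrt t • z) =
      ENNReal.ofReal (Real.sqrt t ^ d) * (fun x => ENNReal.ofReal (heatKernel d t x) * f x)
        (Real.sqrt t • z) := by
    intro z
    simp only
    rw [← mul_assoc, ← ENNReal.ofReal_mul (by positivity)]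
    congr 2
    unfold heatKernel
    rw [norm_smul, Real.norm_of_nonneg hst.le, mul_pow, Real.sq_sqrt ht.le,
      Real.mul_rpow (x := 4 * Real.pi) (by positivity) ht.le, mul_one, mul_one,
      Real.sqrt_eq_rpow, ← Real.rpow_natCast (t ^ (1 / 2 : ℝ)) d, ← Real.rpow_mul ht.le,
      show (1 / 2 : ℝ) * d = d / 2 by ring,
      show -(t * ‖z‖ ^ 2) / (4 * t) = -‖z‖ ^ 2 / 4 by field_simp]
    field_simp
  rw [lintegral_congr h1]
  have hm : Measurable fun x => ENNReal.ofReal (heatKernel d t x) * f x :=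
    ((continuous_heatKernel d t).measurable.ennreal_ofReal).mul hf
  rw [lintegral_const_mul' _ _ ENNReal.ofReal_ne_top,
    ← lintegral_map (μ := volume) (g := fun z : Space d => Real.sqrt t • z) hm (by fun_prop),
    Measure.map_addHaar_smul volume hst.ne', lintegral_smul_measure, smul_eq_mul, ← mul_assoc,
    ← ENNReal.ofReal_mul (by positivity), finrank_euclideanSpace_fin, abs_of_pos (by positivity),
    mul_inv_cancel₀ (by positivity), ENNReal.ofReal_one, one_mul]

/-- The prefactors differ by 2^{d/2} and the exponential decays more slowly at time 2t. This
constant dictates ε in `exists_dissipation`. -/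
lemma heatKernel_le_two_mul {d : ℕ} {t : ℝ} (ht : 0 < t) (x : Space d) :
    heatKernel d t x ≤ 2 ^ ((d : ℝ) / 2) * heatKernel d (2 * t) x := by
  unfold heatKernel
  rw [show 4 * Real.pi * (2 * t) = 2 * (4 * Real.pi * t) by ring,
    Real.mul_rpow (x := 2) (by norm_num) (by positivity)]
  have p1 : 0 < (4 * Real.pi * t) ^ ((d : ℝ) / 2) := by positivity
  generalize (4 * Real.pi * t) ^ ((d : ℝ) / 2) = a at *
  have : Real.exp (-‖x‖ ^ 2 / (4 * t)) ≤ Real.exp (-‖x‖ ^ 2 / (4 * (2 * t))) := by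
    rw [neg_div, neg_div]
    gcongr
    linarith
  calc _ ≤ 1 / a * Real.exp (-‖x‖ ^ 2 / (4 * (2 * t))) := by gcongr
    _ = _ := by field_simp

/-- Half of the Gaussian exponent absorbs ‖z‖², through u + 1 ≤ e^u at u = ‖z‖²/8; a multiple of K_2
remains. -/
lemma lintegral_sq_heatMeasure_lt_top (d : ℕ) : ∫⁻ z, ‖z‖ₑ ^ 2 ∂heatMeasure d 1 < ∞ := by
  have h1 : ∀ z : Space d, ENNReal.ofReal (heatKernel d 1 z) * ‖z‖ₑ ^ 2 ≤
      ENNReal.ofReal (8 * 2 ^ ((d : ℝ) / 2)) * ENNReal.ofReal (heatKernel d 2 z) := by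
    intro z
    rw [← ofReal_norm, ← ENNReal.ofReal_pow (norm_nonneg _),
      ← ENNReal.ofReal_mul (heatKernel_pos one_pos _).le, ← ENNReal.ofReal_mul (by positivity)]
    apply ENNReal.ofReal_le_ofReal
    unfold heatKernel
    rw [show 4 * Real.pi * 2 = 2 * (4 * Real.pi * 1) by ring,
      Real.mul_rpow (x := 2) (by norm_num) (by positivity),
      show -‖z‖ ^ 2 / (4 * 1) = -‖z‖ ^ 2 / (4 * 2) + -(‖z‖ ^ 2 / 8) by ring, Real.exp_add]
    have h2 : ‖z‖ ^ 2 * Real.exp (-(‖z‖ ^ 2 / 8)) ≤ 8 := by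
      rw [Real.exp_neg, ← div_eq_mul_inv, div_le_iff₀ (Real.exp_pos _)]
      have := Real.add_one_le_exp (‖z‖ ^ 2 / 8)
      linarith
    have p1 : 0 < (4 * Real.pi * 1) ^ ((d : ℝ) / 2) := by positivity
    generalize (4 * Real.pi * 1) ^ ((d : ℝ) / 2) = a at *
    calc _ = (1 / a * Real.exp (-‖z‖ ^ 2 / (4 * 2))) *
          (‖z‖ ^ 2 * Real.exp (-(‖z‖ ^ 2 / 8))) := by ring
      _ ≤ (1 / a * Real.exp (-‖z‖ ^ 2 / (4 * 2))) * 8 := by gcongr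
      _ = _ := by field_simp
  have hp := isProbabilityMeasure_heatMeasure (d := d) (t := 2) (by norm_num)
  have h3 := hp.measure_univ
  rw [← lintegral_one, lintegral_heatMeasure measurable_const] at h3
  simp only [mul_one] at h3
  rw [lintegral_heatMeasure (by fun_prop)]
  refine (lintegral_mono h1).trans_lt ?_
  rw [lintegral_const_mul' _ _ ENNReal.ofReal_ne_top, h3]
  exact ENNReal.mul_lt_top ENNReal.ofReal_lt_top ENNReal.one_lt_top

lemma heatFlow_of_pos {d : ℕ} {t : ℝ} (ht : 0 < t) (ρ : Measure (Space d)) :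
    heatFlow t ρ = (heatMeasure d t).conv ρ := by
  rw [heatFlow, if_neg ht.ne', heatMeasure]

lemma heatFlow_eq_map {d : ℕ} {t : ℝ} (ht : 0 ≤ t) (ρ : Measure (Space d)) [IsFiniteMeasure ρ] :
    heatFlow t ρ = ((heatMeasure d 1).prod ρ).map (fun p => Real.sqrt t • p.1 + p.2) := by
  rcases ht.eq_or_lt with rfl | ht
  · simp [heatFlow, Measure.map_snd_prod]
  · rw [heatFlow_of_pos ht, heatMeasure_eq_map ht, Measure.conv]
    nth_rewrite 1 [← Measure.map_id (μ := ρ)]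
    rw [Measure.map_prod_map _ _ (by fun_prop) measurable_id, Measure.map_map (by fun_prop) (by fun_prop)]
    rfl

lemma heatFlow_univ {d : ℕ} {t : ℝ} (ht : 0 ≤ t) (ρ : Measure (Space d)) [IsFiniteMeasure ρ] :
    heatFlow t ρ univ = ρ univ := by
  rw [heatFlow_eq_map ht, Measure.map_apply (by fun_prop) MeasurableSet.univ, preimage_univ,
    Measure.prod_apply MeasurableSet.univ]
  simp

lemma isFiniteMeasure_heatFlow {d : ℕ} {t : ℝ} (ht : 0 ≤ t) (ρ : Measure (Space d))
    [IsFiniteMeasure ρ] : IsFiniteMeasure (heatFlow t ρ) :=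
  ⟨by rw [heatFlow_univ ht]; exact measure_lt_top _ _⟩

/-! ### Splitting the Coulomb profile: short-time heat potential plus controlled growth. -/

/-- At r = 1 and s ≤ 1 the profile is at most twice the radial derivative, already known to be
integrable; any other admissible r differs from r = 1 by an integrable function. -/
lemma integrableOn_gaussProfile {d : ℕ} (hd : 1 ≤ d) {r : ℝ} (hr : 0 < r ∨ d = 1 ∧ 0 ≤ r) :
    IntegrableOn (fun s => gaussProfile d s r) (Ioc 0 1) := by
  have h1 : IntegrableOn (fun s => gaussProfile d s 1) (Ioc 0 1) := by
    have h : IntegrableOn (fun s => 1 / (2 * s) * gaussProfile d s 1) (Ioi 0) := by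
      apply Integrable.of_integral_ne_zero
      rw [integral_radial_deriv hd one_pos]
      have := sphereConst_pos hd
      positivity
    refine Integrable.mono' ((h.mono_set Ioc_subset_Ioi_self).const_mul 2)
      (measurable_gaussProfile_time d 1).aestronglyMeasurable ?_
    refine (ae_restrict_iff' measurableSet_Ioc).2 (ae_of_all _ fun s hs => ?_)
    have h0 := gaussProfile_pos d hs.1 1
    have hs0 := hs.1
    rw [Real.norm_of_nonneg h0.le, ← mul_assoc]
    apply le_mul_of_one_le_left h0.le
    rw [mul_one_div, div_mul_eq_div_div, div_self two_ne_zero]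
    exact (one_le_div hs.1).2 hs.2
  refine (((integral_gaussProfile_sub hd hr).1.mono_set Ioc_subset_Ioi_self).add h1).congr
    (ae_of_all _ fun s => ?_)
  simp

/-- The difference gains a factor 1/s over s^{-d/2}. It dominates the large-time part of the kernel
uniformly in r ≤ 1. -/
lemma integrableOn_gaussProfile_zero_sub {d : ℕ} (hd : 1 ≤ d) :
    IntegrableOn (fun s => gaussProfile d s 0 - gaussProfile d s 1) (Ioi 1) := by
  have hd' : (1 : ℝ) ≤ d := by exact_mod_cast hd
  refine Integrable.mono' (integrableOn_Ioi_rpow_of_lt (a := -((d : ℝ) / 2) - 1) (by linarith) one_pos)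
    (((measurable_gaussProfile_time d 0).sub (measurable_gaussProfile_time d 1)).aestronglyMeasurable) ?_
  refine (ae_restrict_iff' measurableSet_Ioi).2 (ae_of_all _ fun s hs => ?_)
  have hs1 : 1 < s := hs
  have hs0 : 0 < s := by linarith
  rw [Real.norm_of_nonneg (sub_nonneg.2 (gaussProfile_anti d hs0 le_rfl zero_le_one))]
  unfold gaussProfile
  have e1 : Real.exp (-(0 : ℝ) ^ 2 / (4 * s)) = 1 := by norm_num
  have e2 : 1 - Real.exp (-(1 : ℝ) ^ 2 / (4 * s)) ≤ 1 / s := by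
    have h := Real.add_one_le_exp (-(1 : ℝ) ^ 2 / (4 * s))
    have h3 : -(1 : ℝ) ^ 2 / (4 * s) = -(1 / s) / 4 := by field_simp
    rw [h3] at h ⊢
    have : 0 < 1 / s := by positivity
    linarith
  have e3 : 1 / (4 * Real.pi * s) ^ ((d : ℝ) / 2) ≤ s ^ (-((d : ℝ) / 2)) := by
    rw [Real.rpow_neg hs0.le, ← one_div]
    have := Real.pi_gt_three
    gcongr
    nlinarith
  rw [e1, ← mul_sub, Real.rpow_sub hs0, Real.rpow_one, div_eq_mul_one_div (s ^ _)]
  have : 0 ≤ 1 - Real.exp (-(1 : ℝ) ^ 2 / (4 * s)) := by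
    rw [sub_nonneg, Real.exp_le_one_iff, neg_div]
    have : 0 ≤ (1 : ℝ) ^ 2 / (4 * s) := by positivity
    linarith
  exact mul_le_mul e3 e2 this (by positivity)

/-- The growth of `G` at infinity, up to constants. -/
def growthProfile (d : ℕ) (r : ℝ) : ℝ :=
  if d = 1 then r else if d = 2 then Real.log (1 + r) else 0

lemma growthProfile_nonneg (d : ℕ) {r : ℝ} (hr : 0 ≤ r) : 0 ≤ growthProfile d r := by
  unfold growthProfile
  split_ifs
  · exact hr
  · exact Real.log_nonneg (by linarith)
  · exact le_rfl

lemma growthProfile_le (d : ℕ) {r : ℝ} (hr : 0 ≤ r) : growthProfile d r ≤ r := by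
  unfold growthProfile
  split_ifs
  · exact le_rfl
  · have := Real.log_le_sub_one_of_pos (x := 1 + r) (by linarith)
    linarith
  · exact hr

lemma growthProfile_mono (d : ℕ) {a b : ℝ} (ha : 0 ≤ a) (hab : a ≤ b) :
    growthProfile d a ≤ growthProfile d b := by
  unfold growthProfile
  split_ifs
  · exact hab
  · exact Real.log_le_log (by linarith) (by linarith)
  · exact le_rfl

lemma growthProfile_add_le (d : ℕ) {a b : ℝ} (ha : 0 ≤ a) (hb : 0 ≤ b) :
    growthProfile d (a + b) ≤ growthProfile d a + growthProfile d b := by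
  unfold growthProfile
  split_ifs
  · exact le_rfl
  · rw [← Real.log_mul (by positivity) (by positivity)]
    apply Real.log_le_log (by positivity)
    nlinarith [mul_nonneg ha hb]
  · norm_num

lemma growthProfile_le_abs_add (d : ℕ) {r : ℝ} (hr : 0 ≤ r) :
    growthProfile d r ≤ |coulombProfile d r| + 1 := by
  unfold growthProfile
  split_ifs with h1 h2
  · subst h1
    norm_num [coulombProfile]
    rw [div_neg, abs_neg, div_one, abs_of_nonneg hr]; linarith
  · subst h2
    norm_num [coulombProfile]
    have hl2 : Real.log 2 ≤ 1 := by have := Real.log_two_lt_d9; linarith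
    rcases le_total r 1 with h | h
    · have : Real.log (1 + r) ≤ Real.log 2 := Real.log_le_log (by linarith) (by linarith)
      have := abs_nonneg (Real.log r)
      linarith
    · have : Real.log (1 + r) ≤ Real.log (2 * r) := Real.log_le_log (by linarith) (by linarith)
      rw [Real.log_mul two_ne_zero (by linarith)] at this
      have := le_abs_self (Real.log r)
      linarith
  · positivity

lemma abs_coulombProfile_le {d : ℕ} (hd : 1 ≤ d) {r : ℝ} (hr : 1 ≤ r) :
    |coulombProfile d r| ≤ 1 + growthProfile d r := by
  unfold growthProfile
  split_ifs with h1 h2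
  · subst h1
    norm_num [coulombProfile]
    rw [div_neg, abs_neg, div_one, abs_of_nonneg (by linarith)]; linarith
  · subst h2
    norm_num [coulombProfile]
    rw [abs_of_nonneg (Real.log_nonneg hr)]
    have : Real.log r ≤ Real.log (1 + r) := Real.log_le_log (by linarith) (by linarith)
    linarith
  · have hd3 : (3 : ℝ) ≤ d := by
      have : 3 ≤ d := by omega
      exact_mod_cast this
    unfold coulombProfile
    rw [if_neg (by linarith), abs_of_nonneg (div_nonneg (by positivity) (by linarith)), add_zero]
    apply div_le_one_of_le₀ _ (by linarith)
    exact (Real.rpow_le_one_of_one_le_of_nonpos hr (by linarith)).trans (by linarith)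

/-- The Coulomb kernel is the potential of the heat kernel up to time `1`, modulo a remainder
controlled by the growth at infinity. -/
lemma exists_abs_coulombProfile_sub_le {d : ℕ} (hd : 1 ≤ d) :
    ∃ C : ℝ, 0 ≤ C ∧ ∀ r : ℝ, (0 < r ∨ d = 1 ∧ 0 ≤ r) →
      |coulombProfile d r - (sphereConst d)⁻¹ * ∫ s in Ioc (0 : ℝ) 1, gaussProfile d s r| ≤
        C * (1 + growthProfile d r) := by
  set c := (sphereConst d)⁻¹ with hc
  have hcp : 0 < c := inv_pos.2 (sphereConst_pos hd)
  set h : ℝ → ℝ := fun r => ∫ s in Ioc (0 : ℝ) 1, gaussProfile d s r with hh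
  set B := ∫ s in Ioi (1 : ℝ), (gaussProfile d s 0 - gaussProfile d s 1) with hB
  have hhnn : ∀ r, 0 ≤ h r := fun r =>
    setIntegral_nonneg measurableSet_Ioc fun s hs => (gaussProfile_pos d hs.1 r).le
  have hB0 : 0 ≤ B := setIntegral_nonneg measurableSet_Ioi fun s hs =>
    sub_nonneg.2 (gaussProfile_anti d (one_pos.trans hs) le_rfl zero_le_one)
  have h10 : 0 < (1 : ℝ) ∨ d = 1 ∧ 0 ≤ (1 : ℝ) := Or.inl one_pos
  refine ⟨|coulombProfile d 1| + c * h 1 + c * B + 1, by have := hhnn 1; positivity, fun r hr => ?_⟩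
  have hr0 : 0 ≤ r := by rcases hr with h | h; exacts [h.le, h.2]
  have hg := growthProfile_nonneg d hr0
  have hh1 := hhnn 1
  -- Near the pole, the time integral based at r = 1 is cut at s = 1: its large-time part R lies in
  -- [0, B], whatever r ≤ 1.
  rcases le_total r 1 with hr1 | hr1
  · obtain ⟨hi, he⟩ := integral_gaussProfile_sub hd hr
    rw [← Ioc_union_Ioi_eq_Ioi (zero_le_one (α := ℝ)), setIntegral_union Ioc_disjoint_Ioi_same
      measurableSet_Ioi (hi.mono_set Ioc_subset_Ioi_self)
      (hi.mono_set (Ioi_subset_Ioi zero_le_one)),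
      integral_sub (integrableOn_gaussProfile hd hr) (integrableOn_gaussProfile hd h10)] at he
    set R := ∫ s in Ioi (1 : ℝ), (gaussProfile d s r - gaussProfile d s 1) with hR
    have hR0 : 0 ≤ R := setIntegral_nonneg measurableSet_Ioi fun s hs =>
      sub_nonneg.2 (gaussProfile_anti d (one_pos.trans hs) hr0 hr1)
    have hRB : R ≤ B := by
      refine setIntegral_mono_on (hi.mono_set (Ioi_subset_Ioi zero_le_one))
        (integrableOn_gaussProfile_zero_sub hd) measurableSet_Ioi fun s hs => ?_
      exact sub_le_sub_right (gaussProfile_anti d (one_pos.trans hs) le_rfl hr0) _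
    have h5 : coulombProfile d r - c * h r = coulombProfile d 1 - c * h 1 + c * R := by
      have : c * sphereConst d = 1 := inv_mul_cancel₀ (sphereConst_pos hd).ne'
      have h6 : c * (h r - h 1 + R) = c * (sphereConst d * (coulombProfile d r - coulombProfile d 1)) := by
        rw [← he]
      rw [← mul_assoc, this] at h6
      linarith
    rw [h5]
    have h7 : c * R ≤ c * B := by gcongr
    have h8 : |coulombProfile d 1 - c * h 1 + c * R| ≤ |coulombProfile d 1| + c * h 1 + c * B := by
      have ha := abs_le.1 (le_refl |coulombProfile d 1|)
      have h9 : 0 ≤ c * h 1 := by positivity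
      have h10 : 0 ≤ c * R := by positivity
      rw [abs_le]; constructor <;> linarith [ha.1, ha.2]
    have : 0 ≤ c * h 1 := by positivity
    have : 0 ≤ c * B := by positivity
    nlinarith [abs_nonneg (coulombProfile d 1)]
  -- Away from the pole no cancellation is needed: both terms are bounded separately.
  · have h1 := abs_coulombProfile_le hd hr1
    have h2 : h r ≤ h 1 := setIntegral_mono_on (integrableOn_gaussProfile hd hr)
      (integrableOn_gaussProfile hd h10) measurableSet_Ioc fun s hs =>
        gaussProfile_anti d hs.1 zero_le_one hr1
    have h3 : c * h r ≤ c * h 1 := by gcongr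
    have h4 := hhnn r
    have h5 : 0 ≤ c * h r := by positivity
    have h6 : |coulombProfile d r - c * h r| ≤ |coulombProfile d r| + c * h r :=
      (abs_sub _ _).trans (by rw [abs_of_nonneg h5])
    have : 0 ≤ c * B := by positivity
    nlinarith [abs_nonneg (coulombProfile d 1)]

/-! ### The Coulomb kernel, its pole and its comparison with the heat potential. -/

/-- Valid even at the pole thanks to default values: `toReal` sends ⊤ to 0, while log 0 = 0 and 0 to
a nonzero real power is 0. -/
lemma coulombKernel_toReal (d : ℕ) (x y : Space d) :
    (coulombKernel d x y).toReal = coulombProfile d ‖x - y‖ := by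
  unfold coulombKernel rieszKernel coulombProfile
  split_ifs with h1 h2 h3
  · simp [h1.1]
  · rw [h1.1, sub_self, norm_zero, Real.zero_rpow (neg_ne_zero.2 h2)]
    simp
  · rfl
  · rfl

lemma coulombKernel_abs {d : ℕ} (hd : 1 ≤ d) {x y : Space d} (h : x ≠ y ∨ d = 1) :
    (coulombKernel d x y).abs = ENNReal.ofReal |coulombProfile d ‖x - y‖| := by
  rw [← coulombKernel_toReal, ← EReal.abs_def, EReal.coe_toReal]
  · unfold coulombKernel rieszKernel
    rw [if_neg]
    · split_ifs <;> exact EReal.coe_ne_top _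
    · rcases h with h | rfl
      · tauto
      · norm_num
  · unfold coulombKernel rieszKernel
    split_ifs
    · exact bot_ne_top.symm
    · exact EReal.coe_ne_bot _
    · exact EReal.coe_ne_bot _

lemma coulombKernel_abs_self {d : ℕ} (hd : 2 ≤ d) (x : Space d) :
    (coulombKernel d x x).abs = ⊤ := by
  have : (0 : ℝ) ≤ (d : ℝ) - 2 := by
    have : (2 : ℝ) ≤ d := by exact_mod_cast hd
    linarith
  unfold coulombKernel rieszKernel
  rw [if_pos ⟨rfl, this⟩]
  rfl

lemma measurable_coulombProfile (d : ℕ) : Measurable (coulombProfile d) := by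
  unfold coulombProfile
  split_ifs <;> fun_prop

lemma pole_free {d : ℕ} {x y : Space d} (h : x ≠ y ∨ d = 1) :
    0 < ‖x - y‖ ∨ d = 1 ∧ 0 ≤ ‖x - y‖ :=
  h.imp (fun h => norm_pos_iff.2 (sub_ne_zero.2 h)) (fun h => ⟨h, norm_nonneg _⟩)

/-- The kernel `∫₀¹ K_s ds`. -/
def heatPotential (d : ℕ) (x : Space d) : ℝ≥0∞ :=
  ∫⁻ s in Ioc (0 : ℝ) 1, ENNReal.ofReal (heatKernel d s x)

/-- The growth of the Coulomb kernel as a function on the space. -/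
def growth (d : ℕ) (x : Space d) : ℝ≥0∞ := ENNReal.ofReal (growthProfile d ‖x‖)

lemma measurable_growth (d : ℕ) : Measurable (growth d) := by
  unfold growth growthProfile
  split_ifs <;> fun_prop

lemma growth_add_le {d : ℕ} (x y : Space d) : growth d (x + y) ≤ growth d x + growth d y := by
  unfold growth
  rw [← ENNReal.ofReal_add (growthProfile_nonneg d (norm_nonneg _))
    (growthProfile_nonneg d (norm_nonneg _))]
  exact ENNReal.ofReal_le_ofReal ((growthProfile_mono d (norm_nonneg _) (norm_add_le x y)).trans
    (growthProfile_add_le d (norm_nonneg _) (norm_nonneg _)))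

lemma growth_neg {d : ℕ} (x : Space d) : growth d (-x) = growth d x := by
  simp [growth]

lemma growth_sub_le {d : ℕ} (x y : Space d) : growth d (x - y) ≤ growth d x + growth d y := by
  rw [sub_eq_add_neg]
  exact (growth_add_le _ _).trans_eq (by rw [growth_neg])

lemma growth_le_enorm {d : ℕ} (x : Space d) : growth d x ≤ ‖x‖ₑ := by
  rw [← ofReal_norm]
  exact ENNReal.ofReal_le_ofReal (growthProfile_le d (norm_nonneg _))

lemma growth_sub_le_abs {d : ℕ} (hd : 1 ≤ d) (x y : Space d) :
    growth d (x - y) ≤ (coulombKernel d x y).abs + 1 := by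
  by_cases h : x ≠ y ∨ d = 1
  · rw [coulombKernel_abs hd h, ← ENNReal.ofReal_one, ← ENNReal.ofReal_add (abs_nonneg _) zero_le_one]
    exact ENNReal.ofReal_le_ofReal (growthProfile_le_abs_add d (norm_nonneg _))
  · push Not at h
    rw [h.1, coulombKernel_abs_self (by omega)]
    simp

lemma heatPotential_eq {d : ℕ} (hd : 1 ≤ d) {x y : Space d} (h : x ≠ y ∨ d = 1) :
    heatPotential d (x - y) = ENNReal.ofReal (∫ s in Ioc (0 : ℝ) 1, gaussProfile d s ‖x - y‖) := by
  rw [ofReal_integral_eq_lintegral_ofReal (integrableOn_gaussProfile hd (pole_free h))]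
  · rfl
  · exact (ae_restrict_iff' measurableSet_Ioc).2 (ae_of_all _ fun s hs => (gaussProfile_pos d hs.1 _).le)

/-- The first bound turns tameness into finite energy, the second does the converse. The second
needs no condition on the pair, since for d ≥ 2 the right-hand side is infinite on the diagonal. -/
lemma exists_kernel_bounds {d : ℕ} (hd : 1 ≤ d) : ∃ C : ℝ,
    (∀ x y : Space d, x ≠ y ∨ d = 1 → (coulombKernel d x y).abs ≤
      ENNReal.ofReal (sphereConst d)⁻¹ * heatPotential d (x - y) +
        ENNReal.ofReal C * (1 + growth d (x - y))) ∧
    (∀ x y : Space d, ENNReal.ofReal (sphereConst d)⁻¹ * heatPotential d (x - y) ≤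
      (coulombKernel d x y).abs + ENNReal.ofReal C * (1 + growth d (x - y))) := by
  obtain ⟨C, hC, h⟩ := exists_abs_coulombProfile_sub_le hd
  have hc := inv_pos.2 (sphereConst_pos hd)
  have hnn : ∀ r : ℝ, 0 ≤ ∫ s in Ioc (0 : ℝ) 1, gaussProfile d s r := fun r =>
    setIntegral_nonneg measurableSet_Ioc fun s hs => (gaussProfile_pos d hs.1 r).le
  have hb : ∀ x y : Space d, ENNReal.ofReal C * (1 + growth d (x - y)) =
      ENNReal.ofReal (C * (1 + growthProfile d ‖x - y‖)) := fun x y => by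
    rw [growth, ← ENNReal.ofReal_one, ← ENNReal.ofReal_add zero_le_one
      (growthProfile_nonneg d (norm_nonneg _)), ← ENNReal.ofReal_mul hC]
  have hp : ∀ x y : Space d, 0 ≤ C * (1 + growthProfile d ‖x - y‖) := fun x y =>
    mul_nonneg hC (add_nonneg zero_le_one (growthProfile_nonneg d (norm_nonneg _)))
  refine ⟨C, fun x y hxy => ?_, fun x y => ?_⟩
  · rw [coulombKernel_abs hd hxy, heatPotential_eq hd hxy, hb, ← ENNReal.ofReal_mul hc.le,
      ← ENNReal.ofReal_add (mul_nonneg hc.le (hnn _)) (hp x y)]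
    apply ENNReal.ofReal_le_ofReal
    have h1 := h _ (pole_free hxy)
    have h2 := mul_nonneg hc.le (hnn ‖x - y‖)
    rw [abs_le] at h1
    have h3 := hp x y
    rw [abs_le]; constructor <;> linarith
  · by_cases hxy : x ≠ y ∨ d = 1
    · rw [coulombKernel_abs hd hxy, heatPotential_eq hd hxy, hb, ← ENNReal.ofReal_mul hc.le,
        ← ENNReal.ofReal_add (abs_nonneg _) (hp x y)]
      apply ENNReal.ofReal_le_ofReal
      have h1 := (abs_le.1 (h _ (pole_free hxy))).1
      have := le_abs_self (coulombProfile d ‖x - y‖)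
      linarith
    · push Not at hxy
      rw [hxy.1, coulombKernel_abs_self (by omega)]
      simp

/-! ### The heat pairing of two measures. -/

/-- The pairing `∬ K_s(x - y) dα(x) dβ(y)`. -/
def heatPairing (d : ℕ) (s : ℝ) (α β : Measure (Space d)) : ℝ≥0∞ :=
  ∫⁻ x, ∫⁻ y, ENNReal.ofReal (heatKernel d s (x - y)) ∂β ∂α

@[fun_prop]
lemma _root_.Measurable.heatKernel {d : ℕ} {Y : Type*} [MeasurableSpace Y] {f : Y → ℝ}
    {g : Y → Space d} (hf : Measurable f) (hg : Measurable g) :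
    Measurable fun y => heatKernel d (f y) (g y) :=
  (measurable_heatKernel d).comp (hf.prodMk hg)

lemma measurable_ofReal_heatKernel (d : ℕ) :
    Measurable fun p : ℝ × Space d => ENNReal.ofReal (heatKernel d p.1 p.2) :=
  (measurable_heatKernel d).ennreal_ofReal

lemma measurable_heatPotential (d : ℕ) : Measurable (heatPotential d) := by
  unfold heatPotential
  exact (measurable_ofReal_heatKernel d).lintegral_prod_left'

lemma heatPairing_mono {d : ℕ} {α β α' β' : Measure (Space d)} (s : ℝ) (hα : α ≤ α') (hβ : β ≤ β') :
    heatPairing d s α β ≤ heatPairing d s α' β' :=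
  lintegral_mono' hα fun _ => lintegral_mono' hβ le_rfl

lemma heatPairing_add_left {d : ℕ} {α β : Measure (Space d)} (s : ℝ) (γ : Measure (Space d)) :
    heatPairing d s (α + β) γ = heatPairing d s α γ + heatPairing d s β γ :=
  lintegral_add_measure _ _ _

lemma heatPairing_le {d : ℕ} {α β : Measure (Space d)} {s : ℝ} (hs : 0 < s) :
    heatPairing d s α β ≤
      ENNReal.ofReal (1 / (4 * Real.pi * s) ^ ((d : ℝ) / 2)) * (α univ * β univ) := by
  unfold heatPairing
  calc _ ≤ ∫⁻ x, ∫⁻ y, ENNReal.ofReal (1 / (4 * Real.pi * s) ^ ((d : ℝ) / 2)) ∂β ∂α := by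
        refine lintegral_mono fun x => lintegral_mono fun y => ?_
        exact ENNReal.ofReal_le_ofReal (gaussProfile_le d hs _)
    _ = _ := by simp; ring

section pairing

variable {d : ℕ} {α β : Measure (Space d)} [IsFiniteMeasure α] [IsFiniteMeasure β]

lemma measurable_heatPairing : Measurable fun s => heatPairing d s α β := by
  unfold heatPairing
  apply Measurable.lintegral_prod_right' (f := fun q : ℝ × Space d =>
    ∫⁻ y, ENNReal.ofReal (heatKernel d q.1 (q.2 - y)) ∂β)
  apply Measurable.lintegral_prod_right'
    (f := fun q : (ℝ × Space d) × Space d => ENNReal.ofReal (heatKernel d q.1.1 (q.1.2 - q.2)))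
  fun_prop

lemma heatPairing_comm (s : ℝ) : heatPairing d s α β = heatPairing d s β α := by
  unfold heatPairing
  rw [lintegral_lintegral_swap]
  · simp_rw [heatKernel_sub_comm d s]
  · exact Measurable.aemeasurable (by unfold Function.uncurry; fun_prop)

lemma lintegral_heatKernel_sub_mul {s t : ℝ} (hs : 0 < s) (ht : 0 < t) (x y : Space d) :
    ∫⁻ z, ENNReal.ofReal (heatKernel d s (x - z)) * ENNReal.ofReal (heatKernel d t (y - z)) =
      ENNReal.ofReal (heatKernel d (s + t) (x - y)) := by
  have hc := continuous_heatKernel d s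
  rw [← lintegral_heatKernel_add hs ht, lintegral_heatMeasure (by fun_prop),
    ← lintegral_sub_left_eq_self _ y]
  refine lintegral_congr fun z => ?_
  rw [mul_comm, sub_sub_cancel, show x - y + z = x - (y - z) by abel]

/-- Since K_s = K_{s/2} ⋆ K_{s/2}, the pairing is ∫ u_α u_β with u_α = K_{s/2} ⋆ α, and u v ≤ u² +
v². This substitute for Cauchy–Schwarz bounds cross energies by self-energies. -/
lemma heatPairing_le_add {s : ℝ} (hs : 0 < s) :
    heatPairing d s α β ≤ heatPairing d s α α + heatPairing d s β β := by
  set k : Space d → ℝ≥0∞ := fun x => ENNReal.ofReal (heatKernel d (s / 2) x) with hk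
  have hkm : Measurable k := (continuous_heatKernel d _).measurable.ennreal_ofReal
  set u : Measure (Space d) → Space d → ℝ≥0∞ := fun α z => ∫⁻ x, k (x - z) ∂α with hu
  have hum : ∀ α [IsFiniteMeasure α], Measurable (u α) := fun α _ => by
    apply Measurable.lintegral_prod_left'
      (f := fun p : Space d × Space d => k (p.1 - p.2))
    fun_prop
  have key : ∀ (α β : Measure (Space d)) [IsFiniteMeasure α] [IsFiniteMeasure β],
      heatPairing d s α β = ∫⁻ z, u α z * u β z := by
    intro α β _ _
    have h1 : ∀ x y : Space d, ENNReal.ofReal (heatKernel d s (x - y)) =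
        ∫⁻ z, k (x - z) * k (y - z) := fun x y => by
      rw [lintegral_heatKernel_sub_mul (half_pos hs) (half_pos hs), add_halves]
    unfold heatPairing
    simp_rw [h1]
    have h2 : ∀ x : Space d, ∫⁻ y, (∫⁻ z, k (x - z) * k (y - z)) ∂β =
        ∫⁻ z, k (x - z) * u β z := fun x => by
      rw [lintegral_lintegral_swap]
      · refine lintegral_congr fun z => ?_
        rw [lintegral_const_mul _ (by fun_prop)]
      · exact Measurable.aemeasurable (by unfold Function.uncurry; fun_prop)
    simp_rw [h2]
    have := hum β
    rw [lintegral_lintegral_swap]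
    · refine lintegral_congr fun z => ?_
      rw [lintegral_mul_const _ (by fun_prop)]
    · exact Measurable.aemeasurable (by unfold Function.uncurry; fun_prop)
  have hmα := hum α
  rw [key, key, key, ← lintegral_add_left (by fun_prop)]
  refine lintegral_mono fun z => ?_
  rcases le_total (u α z) (u β z) with h | h
  · exact (mul_le_mul_left h _).trans le_add_self
  · exact (mul_le_mul_right h _).trans le_self_add

lemma heatPairing_lt_top {s : ℝ} (hs : 0 < s) : heatPairing d s α β < ∞ :=
  (heatPairing_le hs).trans_lt (ENNReal.mul_lt_top ENNReal.ofReal_lt_top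
    (ENNReal.mul_lt_top (measure_lt_top _ _) (measure_lt_top _ _)))

/-- The convolution is moved from the measure to the kernel, where the semigroup law turns it into a
time shift. -/
lemma heatPairing_heatFlow {s t : ℝ} (hs : 0 < s) (ht : 0 < t) :
    heatPairing d s (heatFlow t α) β = heatPairing d (s + t) α β := by
  have := isProbabilityMeasure_heatMeasure (d := d) ht
  unfold heatPairing
  rw [heatFlow_of_pos ht, Measure.lintegral_conv]
  · rw [lintegral_lintegral_swap]
    · refine lintegral_congr fun x => ?_
      rw [lintegral_lintegral_swap]
      · refine lintegral_congr fun y => ?_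
        rw [← lintegral_heatKernel_add hs ht]
        refine lintegral_congr fun z => ?_
        rw [show x - y + z = z + x - y by abel]
      · exact Measurable.aemeasurable (by unfold Function.uncurry; fun_prop)
    · refine Measurable.aemeasurable ?_
      unfold Function.uncurry
      apply Measurable.lintegral_prod_right'
        (f := fun q : (Space d × Space d) × Space d => ENNReal.ofReal (heatKernel d s (q.1.1 + q.1.2 - q.2)))
      fun_prop
  · apply Measurable.lintegral_prod_right'
      (f := fun q : Space d × Space d => ENNReal.ofReal (heatKernel d s (q.1 - q.2)))
    fun_prop

lemma lintegral_heatPotential_eq :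
    ∫⁻ x, ∫⁻ y, heatPotential d (x - y) ∂β ∂α = ∫⁻ s in Ioc (0 : ℝ) 1, heatPairing d s α β := by
  unfold heatPotential heatPairing
  have h1 : ∀ x : Space d, ∫⁻ y, (∫⁻ s in Ioc (0 : ℝ) 1, ENNReal.ofReal (heatKernel d s (x - y))) ∂β =
      ∫⁻ s in Ioc (0 : ℝ) 1, ∫⁻ y, ENNReal.ofReal (heatKernel d s (x - y)) ∂β := fun x => by
    rw [lintegral_lintegral_swap]
    exact Measurable.aemeasurable (by unfold Function.uncurry; fun_prop)
  simp_rw [h1]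
  rw [lintegral_lintegral_swap]
  refine Measurable.aemeasurable ?_
  unfold Function.uncurry
  apply Measurable.lintegral_prod_right'
    (f := fun q : (Space d × ℝ) × Space d => ENNReal.ofReal (heatKernel d q.1.2 (q.1.1 - q.2)))
  fun_prop

end pairing

/-! ### Tame measures: finite energy in terms of the heat kernel. -/

/-- The measures of finite energy, described by the heat kernel. -/
structure IsTame {d : ℕ} (α : Measure (Space d)) : Prop where
  finite : IsFiniteMeasure α
  energy : ∫⁻ s in Ioc (0 : ℝ) 1, heatPairing d s α α < ∞
  moment : ∫⁻ x, growth d x ∂α < ∞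
  atoms : 2 ≤ d → ∀ x, α {x} = 0

namespace IsTame

variable {d : ℕ} {α β : Measure (Space d)}

lemma mono (hα : IsTame α) (h : β ≤ α) : IsTame β where
  finite := have := hα.finite; isFiniteMeasure_of_le α h
  energy := (lintegral_mono fun s => have := hα.finite; have := isFiniteMeasure_of_le α h
    heatPairing_mono s h h).trans_lt hα.energy
  moment := (lintegral_mono' h le_rfl).trans_lt hα.moment
  atoms hd x := le_antisymm ((h _).trans_eq (hα.atoms hd x)) zero_le

lemma lintegral_heatPairing_lt_top (hα : IsTame α) (hβ : IsTame β) :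
    ∫⁻ s in Ioc (0 : ℝ) 1, heatPairing d s α β < ∞ := by
  have := hα.finite
  have := hβ.finite
  calc _ ≤ ∫⁻ s in Ioc (0 : ℝ) 1, (heatPairing d s α α + heatPairing d s β β) :=
        setLIntegral_mono' measurableSet_Ioc fun s hs => heatPairing_le_add hs.1
    _ = _ := lintegral_add_left measurable_heatPairing _
    _ < ∞ := ENNReal.add_lt_top.2 ⟨hα.energy, hβ.energy⟩

lemma add (hα : IsTame α) (hβ : IsTame β) : IsTame (α + β) where
  finite := have := hα.finite; have := hβ.finite; inferInstance
  energy := by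
    have := hα.finite
    have := hβ.finite
    have h : ∀ s ∈ Ioc (0 : ℝ) 1, heatPairing d s (α + β) (α + β) ≤
        3 * (heatPairing d s α α + heatPairing d s β β) := fun s hs => by
      rw [heatPairing_add_left, heatPairing_comm, heatPairing_comm (α := β), heatPairing_add_left,
        heatPairing_add_left, heatPairing_comm (α := β) (β := α)]
      have h := heatPairing_le_add (α := α) (β := β) hs.1
      calc _ ≤ heatPairing d s α α + (heatPairing d s α α + heatPairing d s β β) +
            ((heatPairing d s α α + heatPairing d s β β) + heatPairing d s β β) := by gcongr
        _ = _ := by ring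
    calc _ ≤ ∫⁻ s in Ioc (0 : ℝ) 1, 3 * (heatPairing d s α α + heatPairing d s β β) :=
          setLIntegral_mono' measurableSet_Ioc h
      _ < ∞ := by
        rw [lintegral_const_mul' _ _ (by norm_num), lintegral_add_left measurable_heatPairing]
        exact ENNReal.mul_lt_top (by norm_num) (ENNReal.add_lt_top.2 ⟨hα.energy, hβ.energy⟩)
  moment := by
    rw [lintegral_add_measure]
    exact ENNReal.add_lt_top.2 ⟨hα.moment, hβ.moment⟩
  atoms hd x := by simp [hα.atoms hd x, hβ.atoms hd x]

end IsTame

lemma heatMeasure_singleton {d : ℕ} (hd : 1 ≤ d) (t : ℝ) (x : Space d) : heatMeasure d t {x} = 0 := by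
  have : Nonempty (Fin d) := ⟨⟨0, hd⟩⟩
  have : Nontrivial (Space d) := inferInstance
  exact withDensity_absolutelyContinuous _ _ (measure_singleton x)

lemma heatFlow_singleton {d : ℕ} (hd : 1 ≤ d) {t : ℝ} (ht : 0 < t) (α : Measure (Space d))
    [IsFiniteMeasure α] (x : Space d) : heatFlow t α {x} = 0 := by
  have := isProbabilityMeasure_heatMeasure (d := d) ht
  have hs := measurableSet_singleton x
  rw [heatFlow_of_pos ht, ← lintegral_indicator_one hs,
    Measure.lintegral_conv (measurable_one.indicator hs), lintegral_lintegral_swap]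
  · rw [← lintegral_zero (μ := α)]
    refine lintegral_congr fun y => ?_
    rw [← heatMeasure_singleton hd t (x - y), ← lintegral_indicator_one (measurableSet_singleton _)]
    refine lintegral_congr fun z => ?_
    simp [indicator, eq_sub_iff_add_eq]
  · exact ((measurable_one.indicator hs).comp (measurable_fst.add measurable_snd)).aemeasurable

lemma lintegral_enorm_heatMeasure_lt_top (d : ℕ) {t : ℝ} (ht : 0 < t) :
    ∫⁻ z, ‖z‖ₑ ∂heatMeasure d t < ∞ := by
  rw [heatMeasure_eq_map ht, lintegral_map (by fun_prop) (by fun_prop)]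
  simp_rw [enorm_smul]
  rw [lintegral_const_mul _ (by fun_prop)]
  refine ENNReal.mul_lt_top enorm_lt_top ?_
  have h : ∀ z : Space d, ‖z‖ₑ ≤ 1 + ‖z‖ₑ ^ 2 := fun z => by
    rcases le_total ‖z‖ₑ 1 with h | h
    · exact h.trans le_self_add
    · exact (le_self_pow₀ h two_ne_zero).trans le_add_self
  refine (lintegral_mono h).trans_lt ?_
  rw [lintegral_add_left measurable_const]
  exact ENNReal.add_lt_top.2 ⟨by simp, lintegral_sq_heatMeasure_lt_top d⟩

/-- For t > 0 the flow regularises: all pairings involve kernels at times at least t, bounded by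
(4πt)^{-d/2}. The growth moment survives by subadditivity and the finite first moment of the
Gaussian. -/
lemma IsTame.heatFlow {d : ℕ} (hd : 1 ≤ d) {α : Measure (Space d)} (hα : IsTame α) {t : ℝ}
    (ht : 0 ≤ t) : IsTame (heatFlow t α) := by
  have := hα.finite
  rcases ht.eq_or_lt with rfl | ht
  · rwa [CoulombMMD.heatFlow, if_pos rfl]
  have hfin := isFiniteMeasure_heatFlow ht.le α
  have hprob := isProbabilityMeasure_heatMeasure (d := d) ht
  refine ⟨hfin, ?_, ?_, fun _ x => heatFlow_singleton hd ht α x⟩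
  · have h : ∀ s ∈ Ioc (0 : ℝ) 1, heatPairing d s (CoulombMMD.heatFlow t α) (CoulombMMD.heatFlow t α) ≤
        ENNReal.ofReal (1 / (4 * Real.pi * t) ^ ((d : ℝ) / 2)) *
          (α univ * CoulombMMD.heatFlow t α univ) := fun s hs => by
      rw [heatPairing_heatFlow hs.1 ht]
      refine (heatPairing_le (add_pos hs.1 ht)).trans ?_
      have := hs.1
      gcongr
      linarith
    refine (setLIntegral_mono' measurableSet_Ioc h).trans_lt ?_
    rw [setLIntegral_const]
    exact ENNReal.mul_lt_top (ENNReal.mul_lt_top ENNReal.ofReal_lt_top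
      (ENNReal.mul_lt_top (measure_lt_top _ _) (measure_lt_top _ _))) (by simp)
  · have hg := measurable_growth d
    rw [heatFlow_of_pos ht, Measure.lintegral_conv hg]
    calc _ ≤ ∫⁻ z, ∫⁻ x, (growth d z + growth d x) ∂α ∂heatMeasure d t :=
          lintegral_mono fun z => lintegral_mono fun x => growth_add_le z x
      _ = (∫⁻ z, growth d z ∂heatMeasure d t) * α univ + ∫⁻ x, growth d x ∂α := by
          simp_rw [lintegral_add_left measurable_const]
          rw [lintegral_add_right _ measurable_const]
          simp [lintegral_mul_const _ hg]
      _ < ∞ := ENNReal.add_lt_top.2 ⟨ENNReal.mul_lt_top ((lintegral_mono growth_le_enorm).trans_lt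
          (lintegral_enorm_heatMeasure_lt_top d ht)) (measure_lt_top _ _), hα.moment⟩

/-- The section of the diagonal over x is {x}, which β does not charge when d ≥ 2. -/
lemma ae_pole_free {d : ℕ} (hd : 1 ≤ d) (α : Measure (Space d)) {β : Measure (Space d)}
    (hβ : IsTame β) : ∀ᵐ p ∂(α.prod β), p.1 ≠ p.2 ∨ d = 1 := by
  have := hβ.finite
  rcases hd.eq_or_lt with h | h
  · exact ae_of_all _ fun _ => Or.inr h.symm
  have : ∀ᵐ p ∂(α.prod β), p.1 ≠ p.2 := by
    rw [ae_iff]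
    have hm : MeasurableSet {p : Space d × Space d | ¬ p.1 ≠ p.2} := by
      simp only [not_not]
      exact measurableSet_eq_fun measurable_fst measurable_snd
    rw [Measure.measure_prod_null hm]
    refine ae_of_all _ fun x => ?_
    have : Prod.mk x ⁻¹' {p : Space d × Space d | ¬ p.1 ≠ p.2} = {x} := by
      ext y; simp [eq_comm]
    simp only [this, hβ.atoms h x, Pi.zero_apply]
  filter_upwards [this] with p hp using Or.inl hp

lemma IsTame.lintegral_growth_sub_lt_top {d : ℕ} {α β : Measure (Space d)} (hα : IsTame α)
    (hβ : IsTame β) : ∫⁻ p, growth d (p.1 - p.2) ∂(α.prod β) < ∞ := by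
  have := hα.finite
  have := hβ.finite
  have hg := measurable_growth d
  calc _ ≤ ∫⁻ p, (growth d p.1 + growth d p.2) ∂(α.prod β) :=
        lintegral_mono fun p => growth_sub_le p.1 p.2
    _ = (∫⁻ x, growth d x ∂α) * β univ + (∫⁻ y, growth d y ∂β) * α univ := by
        rw [lintegral_prod _ (by fun_prop)]
        simp_rw [lintegral_add_left measurable_const]
        rw [lintegral_add_right _ measurable_const]
        simp [lintegral_mul_const _ hg]
    _ < ∞ := ENNReal.add_lt_top.2 ⟨ENNReal.mul_lt_top hα.moment (measure_lt_top _ _),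
        ENNReal.mul_lt_top hβ.moment (measure_lt_top _ _)⟩

lemma IsTame.lintegral_heatPotential_lt_top {d : ℕ} {α β : Measure (Space d)} (hα : IsTame α)
    (hβ : IsTame β) : ∫⁻ p, heatPotential d (p.1 - p.2) ∂(α.prod β) < ∞ := by
  have := hα.finite
  have := hβ.finite
  have hg := measurable_heatPotential d
  rw [lintegral_prod _ (by fun_prop), lintegral_heatPotential_eq]
  exact hα.lintegral_heatPairing_lt_top hβ

lemma IsTame.lintegral_abs_lt_top {d : ℕ} (hd : 1 ≤ d) {α β : Measure (Space d)} (hα : IsTame α)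
    (hβ : IsTame β) : ∫⁻ p, (coulombKernel d p.1 p.2).abs ∂(α.prod β) < ∞ := by
  have := hα.finite
  have := hβ.finite
  have hg := measurable_growth d
  have hp := measurable_heatPotential d
  obtain ⟨C, hC, -⟩ := exists_kernel_bounds hd
  refine (lintegral_mono_ae ((ae_pole_free hd α hβ).mono fun p => hC p.1 p.2)).trans_lt ?_
  rw [lintegral_add_left (by fun_prop), lintegral_const_mul _ (by fun_prop),
    lintegral_const_mul _ (by fun_prop), lintegral_add_left (by fun_prop)]
  refine ENNReal.add_lt_top.2 ⟨ENNReal.mul_lt_top ENNReal.ofReal_lt_top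
    (hα.lintegral_heatPotential_lt_top hβ), ENNReal.mul_lt_top ENNReal.ofReal_lt_top
    (ENNReal.add_lt_top.2 ⟨?_, hα.lintegral_growth_sub_lt_top hβ⟩)⟩
  rw [lintegral_one]
  exact measure_lt_top _ _

lemma IsTame.hasFiniteEnergy {d : ℕ} (hd : 1 ≤ d) {α : Measure (Space d)} (hα : IsTame α) :
    HasFiniteEnergy (coulombKernel d) α :=
  hα.lintegral_abs_lt_top hd hα

/-- The kernel comparison bounds the heat energy. For the moment, Fubini gives one x with ∫ growth(x
- y) dα(y) finite, and subadditivity recentres at 0. An atom x would give (x, x) positive mass,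
where |G| = ∞ if d ≥ 2. -/
lemma HasFiniteEnergy.isTame {d : ℕ} (hd : 1 ≤ d) {α : Measure (Space d)} [IsFiniteMeasure α]
    (h : HasFiniteEnergy (coulombKernel d) α) : IsTame α := by
  unfold HasFiniteEnergy at h
  have hg := measurable_growth d
  have hp := measurable_heatPotential d
  have hgrowth : ∫⁻ p, growth d (p.1 - p.2) ∂(α.prod α) < ∞ := by
    have h1 : ∀ p : Space d × Space d, growth d (p.1 - p.2) ≤ (coulombKernel d p.1 p.2).abs + 1 :=
      fun p => growth_sub_le_abs hd p.1 p.2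
    refine (lintegral_mono h1).trans_lt ?_
    rw [lintegral_add_right _ measurable_const]
    exact ENNReal.add_lt_top.2 ⟨h, by rw [lintegral_one]; exact measure_lt_top _ _⟩
  refine ⟨inferInstance, ?_, ?_, fun hd2 x => ?_⟩
  · obtain ⟨C, -, hC⟩ := exists_kernel_bounds hd
    have h1 := lintegral_mono (μ := α.prod α) fun p : Space d × Space d => hC p.1 p.2
    rw [lintegral_const_mul _ (by fun_prop), lintegral_prod _ (by fun_prop),
      lintegral_heatPotential_eq, lintegral_add_right _ (by fun_prop),
      lintegral_const_mul _ (by fun_prop), lintegral_add_left (by fun_prop), lintegral_one] at h1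
    have h2 := h1.trans_lt (ENNReal.add_lt_top.2 ⟨h, ENNReal.mul_lt_top ENNReal.ofReal_lt_top
      (ENNReal.add_lt_top.2 ⟨measure_lt_top _ _, hgrowth⟩)⟩)
    rcases ENNReal.mul_lt_top_iff.1 h2 with h3 | h3 | h3
    · exact h3.2
    · exact absurd h3 (ENNReal.ofReal_pos.2 (inv_pos.2 (sphereConst_pos hd))).ne'
    · rw [h3]; exact ENNReal.zero_lt_top
  · rcases eq_or_ne α 0 with rfl | hα
    · simp
    rw [lintegral_prod _ (by fun_prop)] at hgrowth
    have hae := ae_lt_top (Measurable.lintegral_prod_right'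
      (f := fun p : Space d × Space d => growth d (p.1 - p.2)) (by fun_prop)) hgrowth.ne
    have : (ae α).NeBot := ae_neBot.2 hα
    obtain ⟨x, hx⟩ := hae.exists
    have h1 : ∀ y, growth d y ≤ growth d x + growth d (x - y) := fun y => by
      conv_lhs => rw [← sub_sub_cancel x y]
      exact growth_sub_le _ _
    refine (lintegral_mono h1).trans_lt ?_
    rw [lintegral_add_left measurable_const, lintegral_const]
    exact ENNReal.add_lt_top.2 ⟨ENNReal.mul_lt_top ENNReal.ofReal_lt_top (measure_lt_top _ _), hx⟩
  · by_contra hx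
    have h1 : ∀ p : Space d × Space d, ({(x, x)} : Set (Space d × Space d)).indicator (fun _ => ⊤) p ≤
        (coulombKernel d p.1 p.2).abs := fun p => by
      by_cases hp : p = (x, x)
      · rw [hp, coulombKernel_abs_self hd2]; exact le_top
      · rw [indicator_of_notMem (by simpa using hp)]; exact zero_le
    have h2 := (lintegral_mono (μ := α.prod α) h1).trans_lt h
    rw [lintegral_indicator_const (measurableSet_singleton _), ← singleton_prod_singleton,
      Measure.prod_prod, ENNReal.top_mul (mul_ne_zero hx hx)] at h2
    exact lt_irrefl _ h2

/-! ### Bilinearity of the mutual energy, and the Jordan decomposition. -/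

lemma integrable_coulombProfile {d : ℕ} (hd : 1 ≤ d) {α β : Measure (Space d)} (hα : IsTame α)
    (hβ : IsTame β) : Integrable (fun p => coulombProfile d ‖p.1 - p.2‖) (α.prod β) := by
  have hm := measurable_coulombProfile d
  refine ⟨Measurable.aestronglyMeasurable (by fun_prop), ?_⟩
  have h := hα.lintegral_abs_lt_top hd hβ
  rw [lintegral_congr_ae ((ae_pole_free hd α hβ).mono fun p hp => coulombKernel_abs hd hp)] at h
  rw [hasFiniteIntegral_iff_norm]
  exact h

lemma mutualEnergy_coulomb (d : ℕ) (α β : Measure (Space d)) :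
    mutualEnergy (coulombKernel d) α β = ∫ p, coulombProfile d ‖p.1 - p.2‖ ∂(α.prod β) := by
  unfold mutualEnergy
  simp_rw [coulombKernel_toReal]

section bilinear

variable {d : ℕ} {α β γ : Measure (Space d)}

lemma mutualEnergy_comm [SFinite α] [SFinite β] :
    mutualEnergy (coulombKernel d) α β = mutualEnergy (coulombKernel d) β α := by
  rw [mutualEnergy_coulomb, mutualEnergy_coulomb, ← integral_prod_swap]
  simp [norm_sub_rev]

lemma mutualEnergy_add_left (hd : 1 ≤ d) (hα : IsTame α) (hβ : IsTame β) (hγ : IsTame γ) :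
    mutualEnergy (coulombKernel d) (α + β) γ =
      mutualEnergy (coulombKernel d) α γ + mutualEnergy (coulombKernel d) β γ := by
  have := hα.finite
  have := hβ.finite
  have := hγ.finite
  rw [mutualEnergy_coulomb, mutualEnergy_coulomb, mutualEnergy_coulomb, Measure.add_prod,
    integral_add_measure (integrable_coulombProfile hd hα hγ) (integrable_coulombProfile hd hβ hγ)]

lemma mutualEnergy_add_right (hd : 1 ≤ d) (hα : IsTame α) (hβ : IsTame β) (hγ : IsTame γ) :
    mutualEnergy (coulombKernel d) γ (α + β) =
      mutualEnergy (coulombKernel d) γ α + mutualEnergy (coulombKernel d) γ β := by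
  have := hα.finite
  have := hβ.finite
  have := hγ.finite
  rw [mutualEnergy_comm, mutualEnergy_add_left hd hα hβ hγ, mutualEnergy_comm,
    mutualEnergy_comm (α := β)]

end bilinear

section jordan

variable {X : Type*} [MeasurableSpace X]

/-- Subtraction-free form of p - n = P - N, to which forms additive on positive measures can be
applied. -/
lemma jordan_add_eq (P N : Measure X) [IsFiniteMeasure P] [IsFiniteMeasure N] :
    (P.toSignedMeasure - N.toSignedMeasure).toJordanDecomposition.posPart + N =
      (P.toSignedMeasure - N.toSignedMeasure).toJordanDecomposition.negPart + P := by
  set j := (P.toSignedMeasure - N.toSignedMeasure).toJordanDecomposition with hj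
  have h : j.toSignedMeasure = P.toSignedMeasure - N.toSignedMeasure :=
    SignedMeasure.toSignedMeasure_toJordanDecomposition _
  ext E hE
  have h1 := congrArg (fun v : SignedMeasure X => v E) h
  simp only [JordanDecomposition.toSignedMeasure, sub_apply,
    Measure.toSignedMeasure_apply_measurable hE] at h1
  rw [Measure.add_apply, Measure.add_apply,
    ← ENNReal.toReal_eq_toReal_iff' (by finiteness) (by finiteness),
    ENNReal.toReal_add (by finiteness) (by finiteness),
    ENNReal.toReal_add (by finiteness) (by finiteness)]
  simp only [Measure.real] at h1
  linarith

/-- Minimality of the Jordan parts: the positive part lives on Sᶜ, where the negative part vanishes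
and the identity gives domination by P; symmetrically on S. -/
lemma jordan_le {P N : Measure X} {j : JordanDecomposition X} (h : j.posPart + N = j.negPart + P) :
    j.posPart ≤ P ∧ j.negPart ≤ N := by
  obtain ⟨S, hS, hp, hn⟩ := j.mutuallySingular
  constructor
  · refine Measure.le_intro fun E hE _ => ?_
    have h1 := congrArg (fun m : Measure X => m (E ∩ Sᶜ)) h
    simp only [Measure.add_apply] at h1
    rw [measure_mono_null inter_subset_right hn, zero_add] at h1
    calc j.posPart E ≤ j.posPart (E ∩ Sᶜ) + j.posPart S := by
          refine (measure_mono ?_).trans (measure_union_le _ _)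
          intro x hx
          by_cases hxS : x ∈ S
          · exact Or.inr hxS
          · exact Or.inl ⟨hx, hxS⟩
      _ = j.posPart (E ∩ Sᶜ) := by rw [hp, add_zero]
      _ ≤ P (E ∩ Sᶜ) := le_self_add.trans_eq h1
      _ ≤ P E := measure_mono inter_subset_left
  · refine Measure.le_intro fun E hE _ => ?_
    have h1 := congrArg (fun m : Measure X => m (E ∩ S)) h
    simp only [Measure.add_apply] at h1
    rw [measure_mono_null inter_subset_right hp, zero_add] at h1
    calc j.negPart E ≤ j.negPart (E ∩ S) + j.negPart Sᶜ := by
          refine (measure_mono ?_).trans (measure_union_le _ _)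
          intro x hx
          by_cases hxS : x ∈ S
          · exact Or.inl ⟨hx, hxS⟩
          · exact Or.inr hxS
      _ = j.negPart (E ∩ S) := by rw [hn, add_zero]
      _ ≤ N (E ∩ S) := le_self_add.trans_eq h1.symm
      _ ≤ N E := measure_mono inter_subset_left

end jordan

lemma energy_sub {d : ℕ} (hd : 1 ≤ d) {P N : Measure (Space d)} [IsFiniteMeasure P]
    [IsFiniteMeasure N] (hP : IsTame P) (hN : IsTame N) :
    energy (coulombKernel d) (P.toSignedMeasure - N.toSignedMeasure) =
      (mutualEnergy (coulombKernel d) P P - 2 * mutualEnergy (coulombKernel d) P N +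
        mutualEnergy (coulombKernel d) N N) / 2 := by
  have h := jordan_add_eq P N
  unfold energy
  obtain ⟨hp, hn⟩ := jordan_le h
  generalize (P.toSignedMeasure - N.toSignedMeasure).toJordanDecomposition.posPart = p at *
  generalize (P.toSignedMeasure - N.toSignedMeasure).toJordanDecomposition.negPart = n at *
  have tp := hP.mono hp
  have tn := hN.mono hn
  -- The identity p + N = n + P is tested on the right against p and n, then on the left against P
  -- and N. These four relations give the energy from any pair (P, N) with the same difference.
  have l1 : ∀ {X : Measure (Space d)}, IsTame X → _ := fun hX =>
    (mutualEnergy_add_left hd tp hN hX).symm.trans ((congrArg (fun m =>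
      mutualEnergy (coulombKernel d) m _) h).trans (mutualEnergy_add_left hd tn hP hX))
  have r1 : ∀ {X : Measure (Space d)}, IsTame X → _ := fun {X} hX =>
    (mutualEnergy_add_right hd tp hN hX).symm.trans ((congrArg (fun m =>
      mutualEnergy (coulombKernel d) X m) h).trans (mutualEnergy_add_right hd tn hP hX))
  have e1 := l1 tp
  have e2 := l1 tn
  have e3 := r1 hP
  have e4 := r1 hN
  rw [mutualEnergy_comm (α := N) (β := P)] at e4
  linarith

/-! ### The real heat form and the dissipation identity. -/

/-- The real-valued pairing `∬ K_s(x - y) dα(x) dβ(y)`. -/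
def heatForm (d : ℕ) (α β : Measure (Space d)) (s : ℝ) : ℝ := (heatPairing d s α β).toReal

section heatForm

variable {d : ℕ} {α β : Measure (Space d)}

lemma heatForm_nonneg (s : ℝ) : 0 ≤ heatForm d α β s := ENNReal.toReal_nonneg

variable [IsFiniteMeasure α] [IsFiniteMeasure β]

lemma measurable_heatForm : Measurable (heatForm d α β) := measurable_heatPairing.ennreal_toReal

lemma ofReal_heatForm {s : ℝ} (hs : 0 < s) :
    ENNReal.ofReal (heatForm d α β s) = heatPairing d s α β :=
  ENNReal.ofReal_toReal (heatPairing_lt_top hs).ne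

lemma integrable_heatKernel_sub {s : ℝ} (hs : 0 < s) :
    Integrable (fun p : Space d × Space d => heatKernel d s (p.1 - p.2)) (α.prod β) := by
  refine Integrable.of_bound (Measurable.aestronglyMeasurable (by fun_prop))
    (1 / (4 * Real.pi * s) ^ ((d : ℝ) / 2)) (ae_of_all _ fun p => ?_)
  rw [Real.norm_of_nonneg (heatKernel_pos hs _).le]
  exact gaussProfile_le d hs _

lemma heatForm_eq_integral {s : ℝ} (hs : 0 < s) :
    heatForm d α β s = ∫ p, heatKernel d s (p.1 - p.2) ∂(α.prod β) := by
  rw [integral_eq_lintegral_of_nonneg_ae (ae_of_all _ fun p => (heatKernel_pos hs _).le)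
    (integrable_heatKernel_sub hs).aestronglyMeasurable, lintegral_prod _ (by fun_prop)]
  rfl

lemma heatForm_le {s : ℝ} (hs : 0 < s) :
    heatForm d α β s ≤ 1 / (4 * Real.pi * s) ^ ((d : ℝ) / 2) * (α.real univ * β.real univ) := by
  refine (ENNReal.toReal_mono (by finiteness) (heatPairing_le hs)).trans_eq ?_
  rw [ENNReal.toReal_mul, ENNReal.toReal_mul, ENNReal.toReal_ofReal (by positivity)]
  rfl

lemma heatForm_heatFlow {s t : ℝ} (hs : 0 < s) (ht : 0 < t) :
    heatForm d (heatFlow t α) β s = heatForm d α β (s + t) := by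
  unfold heatForm
  rw [heatPairing_heatFlow hs ht]

lemma continuousOn_heatForm : ContinuousOn (heatForm d α β) (Ioi 0) := by
  intro t ht
  have ht : 0 < t := ht
  apply ContinuousAt.continuousWithinAt
  have h1 : ContinuousAt (fun s => ∫ p, heatKernel d s (p.1 - p.2) ∂(α.prod β)) t := by
    apply continuousAt_of_dominated (bound := fun _ => 1 / (4 * Real.pi * (t / 2)) ^ ((d : ℝ) / 2))
    · exact Filter.Eventually.of_forall fun s => Measurable.aestronglyMeasurable (by fun_prop)
    · filter_upwards [lt_mem_nhds (half_lt_self ht)] with s hs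
      refine ae_of_all _ fun p => ?_
      have hs0 : 0 < s := (half_pos ht).trans hs
      rw [Real.norm_of_nonneg (heatKernel_pos hs0 _).le]
      refine (gaussProfile_le d hs0 _).trans ?_
      gcongr
    · exact integrable_const _
    · refine ae_of_all _ fun p => ?_
      unfold heatKernel
      refine ContinuousAt.mul (ContinuousAt.div continuousAt_const ?_ (by positivity)) ?_
      · exact ContinuousAt.rpow_const (by fun_prop) (Or.inl (by positivity))
      · refine Real.continuous_exp.continuousAt.comp ?_
        exact ContinuousAt.div continuousAt_const (by fun_prop) (by positivity)
  refine h1.congr ?_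
  filter_upwards [lt_mem_nhds ht] with s hs using (heatForm_eq_integral hs).symm

end heatForm

section flow

variable {d : ℕ} {α β : Measure (Space d)}

lemma IsTame.integrableOn_heatForm (hα : IsTame α) (hβ : IsTame β) (T : ℝ) :
    IntegrableOn (heatForm d α β) (Ioc 0 T) := by
  have := hα.finite
  have := hβ.finite
  have h1 : IntegrableOn (heatForm d α β) (Ioc 0 1) := by
    refine ⟨measurable_heatForm.aestronglyMeasurable, ?_⟩
    rw [hasFiniteIntegral_iff_ofReal (ae_of_all _ fun s => heatForm_nonneg s),
      setLIntegral_congr_fun measurableSet_Ioc fun s hs => ofReal_heatForm hs.1]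
    exact hα.lintegral_heatPairing_lt_top hβ
  have h2 : IntegrableOn (heatForm d α β) (Ioc 1 T) := by
    refine Measure.integrableOn_of_bounded (M := 1 / (4 * Real.pi * 1) ^ ((d : ℝ) / 2) *
      (α.real univ * β.real univ)) (by simp) measurable_heatForm.aestronglyMeasurable ?_
    refine (ae_restrict_iff' measurableSet_Ioc).2 (ae_of_all _ fun s hs => ?_)
    have hs1 := hs.1
    rw [Real.norm_of_nonneg (heatForm_nonneg s)]
    refine (heatForm_le (one_pos.trans hs.1)).trans ?_
    gcongr
  exact (h1.union h2).mono_set Ioc_subset_Ioc_union_Ioc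

lemma IsTame.intervalIntegrable_heatForm (hα : IsTame α) (hβ : IsTame β) {a b : ℝ} (ha : 0 ≤ a)
    (hb : 0 ≤ b) : IntervalIntegrable (heatForm d α β) volume a b := by
  rw [intervalIntegrable_iff]
  exact (hα.integrableOn_heatForm hβ (max a b)).mono_set (Ioc_subset_Ioc_left (le_min ha hb))

/-- Fubini for K_s(x - y) - K_s(1), whose absolute time integral is c |G - G(1)| off the pole. The
counterterm ensures convergence when d ≤ 2 and depends only on the masses, so the flow does not
change it. -/
lemma IsTame.mutualEnergy_eq (hd : 1 ≤ d) (hα : IsTame α) (hβ : IsTame β) :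
    IntegrableOn (fun s => heatForm d α β s - gaussProfile d s 1 * (α.real univ * β.real univ))
      (Ioi 0) ∧
    sphereConst d * mutualEnergy (coulombKernel d) α β =
      sphereConst d * coulombProfile d 1 * (α.real univ * β.real univ) +
        ∫ s in Ioi (0 : ℝ),
          (heatForm d α β s - gaussProfile d s 1 * (α.real univ * β.real univ)) := by
  have := hα.finite
  have := hβ.finite
  have hi := integrable_coulombProfile hd hα hβ
  have hm := measurable_gaussProfile_time d 1
  have hφ := measurable_coulombProfile d
  set F : (Space d × Space d) → ℝ → ℝ := fun p s => heatKernel d s (p.1 - p.2) - gaussProfile d s 1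
    with hF
  have hFm : Measurable (Function.uncurry F) := by unfold Function.uncurry; fun_prop
  have hFi : Integrable (Function.uncurry F) ((α.prod β).prod (volume.restrict (Ioi 0))) := by
    refine ⟨hFm.aestronglyMeasurable, ?_⟩
    rw [hasFiniteIntegral_iff_norm, lintegral_prod _ (by fun_prop)]
    have h1 : ∀ᵐ p ∂(α.prod β), ∫⁻ s in Ioi (0 : ℝ), ENNReal.ofReal ‖Function.uncurry F (p, s)‖ =
        ENNReal.ofReal ‖sphereConst d * (coulombProfile d ‖p.1 - p.2‖ - coulombProfile d 1)‖ := by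
      filter_upwards [ae_pole_free hd α hβ] with p hp
      rw [norm_mul, Real.norm_of_nonneg (sphereConst_pos hd).le, Real.norm_eq_abs,
        ← lintegral_abs_gaussProfile_sub hd (pole_free hp)]
      rfl
    rw [lintegral_congr_ae h1, ← hasFiniteIntegral_iff_norm]
    exact ((hi.sub (integrable_const _)).const_mul _).hasFiniteIntegral
  have hs : ∀ s ∈ Ioi (0 : ℝ), ∫ p, F p s ∂(α.prod β) =
      heatForm d α β s - gaussProfile d s 1 * (α.real univ * β.real univ) := fun s hs => by
    rw [hF, integral_sub (integrable_heatKernel_sub hs) (integrable_const _),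
      heatForm_eq_integral hs, integral_const, smul_eq_mul, mul_comm, ← univ_prod_univ,
      measureReal_prod_prod]
  constructor
  · refine hFi.integral_prod_right.congr ?_
    exact (ae_restrict_iff' measurableSet_Ioi).2 (ae_of_all _ hs)
  · rw [← setIntegral_congr_fun measurableSet_Ioi hs, ← integral_integral_swap hFi]
    have h2 : ∀ᵐ p ∂(α.prod β), ∫ s in Ioi (0 : ℝ), F p s =
        sphereConst d * (coulombProfile d ‖p.1 - p.2‖ - coulombProfile d 1) := by
      filter_upwards [ae_pole_free hd α hβ] with p hp
      exact (integral_gaussProfile_sub hd (pole_free hp)).2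
    rw [integral_congr_ae h2, integral_const_mul, integral_sub hi (integrable_const _),
      mutualEnergy_coulomb, integral_const, smul_eq_mul, ← univ_prod_univ, measureReal_prod_prod]
    ring

/-- Telescoping: up to time T the integral is ∫₀^t f minus ∫_T^{T+t} f, and the latter tends to 0.
Integrability of f at infinity is not needed. -/
lemma integral_sub_shift {f : ℝ → ℝ} {t : ℝ} (ht : 0 ≤ t)
    (hf : ∀ a b : ℝ, 0 ≤ a → 0 ≤ b → IntervalIntegrable f volume a b)
    (hlim : Filter.Tendsto f Filter.atTop (nhds 0))
    (hi : IntegrableOn (fun s => f s - f (s + t)) (Ioi 0)) :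
    ∫ s in Ioi (0 : ℝ), (f s - f (s + t)) = ∫ s in (0 : ℝ)..t, f s := by
  have h1 := intervalIntegral_tendsto_integral_Ioi 0 hi Filter.tendsto_id
  refine tendsto_nhds_unique h1 ?_
  have h2 : Filter.Tendsto (fun T => (∫ s in (0 : ℝ)..t, f s) - ∫ s in T..T + t, f s) Filter.atTop
      (nhds ((∫ s in (0 : ℝ)..t, f s) - 0)) := by
    refine Filter.Tendsto.sub tendsto_const_nhds ?_
    rw [Metric.tendsto_atTop]
    intro ε hε
    obtain ⟨N, hN⟩ := (Metric.tendsto_atTop.1 hlim) (ε / (t + 1)) (by positivity)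
    refine ⟨N, fun T hT => ?_⟩
    rw [dist_zero_right]
    have : ‖∫ s in T..T + t, f s‖ ≤ ε / (t + 1) * |T + t - T| := by
      apply intervalIntegral.norm_integral_le_of_norm_le_const
      intro s hs
      rw [uIoc_of_le (by linarith)] at hs
      have := hN s (by linarith [hs.1])
      rw [dist_zero_right] at this
      exact this.le
    refine this.trans_lt ?_
    rw [add_sub_cancel_left, abs_of_nonneg ht, div_mul_eq_mul_div, div_lt_iff₀ (by linarith)]
    nlinarith
  rw [sub_zero] at h2
  refine h2.congr' ?_
  filter_upwards [Filter.eventually_ge_atTop 0] with T hT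
  simp only [id]
  have hsh : IntervalIntegrable (fun s => f (s + t)) volume 0 T := by
    have := (hf t (T + t) ht (by linarith)).comp_add_right t
    simpa using this
  rw [intervalIntegral.integral_sub (hf 0 T le_rfl hT) hsh,
    intervalIntegral.integral_comp_add_right f t, zero_add]
  have a1 := intervalIntegral.integral_add_adjacent_intervals (hf 0 T le_rfl hT) (hf T (T + t) hT (by linarith))
  have a2 := intervalIntegral.integral_add_adjacent_intervals (hf 0 t le_rfl ht) (hf t (T + t) ht (by linarith))
  linarith

lemma tendsto_heatForm_atTop (hd : 1 ≤ d) [IsFiniteMeasure α] [IsFiniteMeasure β] :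
    Filter.Tendsto (heatForm d α β) Filter.atTop (nhds 0) := by
  have h1 : Filter.Tendsto (fun s : ℝ => 1 / (4 * Real.pi * s) ^ ((d : ℝ) / 2) *
      (α.real univ * β.real univ)) Filter.atTop (nhds (0 * (α.real univ * β.real univ))) := by
    refine Filter.Tendsto.mul_const _ ?_
    simp_rw [one_div]
    refine Filter.Tendsto.inv_tendsto_atTop ?_
    refine (tendsto_rpow_atTop (by positivity)).comp ?_
    exact Filter.tendsto_id.const_mul_atTop (by positivity)
  rw [zero_mul] at h1
  refine tendsto_of_tendsto_of_tendsto_of_le_of_le' tendsto_const_nhds h1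
    (Filter.Eventually.of_forall fun s => heatForm_nonneg s) ?_
  filter_upwards [Filter.eventually_gt_atTop 0] with s hs using heatForm_le hs

/-- The heat flow dissipates the mutual energy: `d/dt ∬ G d(K_t ⋆ α) dβ = -c ∬ K_t dα dβ`, in
integrated form. -/
lemma IsTame.mutualEnergy_heatFlow (hd : 1 ≤ d) (hα : IsTame α) (hβ : IsTame β) {t : ℝ}
    (ht : 0 ≤ t) : mutualEnergy (coulombKernel d) (CoulombMMD.heatFlow t α) β =
      mutualEnergy (coulombKernel d) α β -
        (sphereConst d)⁻¹ * ∫ s in (0 : ℝ)..t, heatForm d α β s := by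
  have := hα.finite
  have := hβ.finite
  rcases ht.eq_or_lt with rfl | ht
  · simp [CoulombMMD.heatFlow]
  obtain ⟨i1, e1⟩ := hα.mutualEnergy_eq hd hβ
  obtain ⟨i2, e2⟩ := (hα.heatFlow hd ht.le).mutualEnergy_eq hd hβ
  have hu : (CoulombMMD.heatFlow t α).real univ = α.real univ := by
    simp [Measure.real, heatFlow_univ ht.le]
  have hfl : ∀ s ∈ Ioi (0 : ℝ), heatForm d (CoulombMMD.heatFlow t α) β s -
      gaussProfile d s 1 * ((CoulombMMD.heatFlow t α).real univ * β.real univ) =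
      heatForm d α β (s + t) - gaussProfile d s 1 * (α.real univ * β.real univ) := fun s hs => by
    rw [heatForm_heatFlow hs ht, hu]
  have i3 := i2.congr_fun hfl measurableSet_Ioi
  rw [setIntegral_congr_fun measurableSet_Ioi hfl, hu] at e2
  -- Masses being preserved, the counterterms cancel and only the telescoping integrand remains.
  have h4 : ∀ s, (heatForm d α β s - gaussProfile d s 1 * (α.real univ * β.real univ)) -
      (heatForm d α β (s + t) - gaussProfile d s 1 * (α.real univ * β.real univ)) =
      heatForm d α β s - heatForm d α β (s + t) := fun s => by ring
  have i5 := i1.sub i3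
  have e5 := integral_sub i1 i3
  simp only [h4] at e5
  rw [integral_sub_shift ht.le (fun a b ha hb => hα.intervalIntegrable_heatForm hβ ha hb)
    (tendsto_heatForm_atTop hd) (i5.congr (ae_of_all _ h4))] at e5
  rw [e5, eq_sub_iff_add_eq]
  apply mul_left_cancel₀ (sphereConst_pos hd).ne'
  rw [mul_add, mul_inv_cancel_left₀ (sphereConst_pos hd).ne', e1, e2]
  ring

end flow

/-! ### Mutual singularity: comparison on small balls. -/

lemma measurable_measure_closedBall {d : ℕ} (n : Measure (Space d)) [SFinite n] (r : ℝ) :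
    Measurable fun x => n (Metric.closedBall x r) := by
  have h : MeasurableSet {p : Space d × Space d | dist p.2 p.1 ≤ r} :=
    measurableSet_le (by fun_prop) measurable_const
  exact measurable_measure_prodMk_left (ν := n) h

/-- An open ball is the increasing union of its closed balls of rational radius. Rational radii give
measurability of the good set, open balls are the superlevel sets of the kernel. -/
lemma measure_ball_le {d : ℕ} {p n : Measure (Space d)} {ε : ℝ≥0∞} {x : Space d} {r : ℝ}
    (h : ∀ q : ℚ, 0 < q → (q : ℝ) < r →
      n (Metric.closedBall x q) ≤ ε * p (Metric.closedBall x q)) :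
    n (Metric.ball x r) ≤ ε * p (Metric.ball x r) := by
  have hU : Metric.ball x r ⊆ ⋃ q : {q : ℚ // 0 < q ∧ (q : ℝ) < r}, Metric.closedBall x (q : ℚ) := by
    intro y hy
    obtain ⟨q, hq1, hq2⟩ := exists_rat_btwn (Metric.mem_ball.1 hy)
    have hq0 : (0 : ℝ) < q := dist_nonneg.trans_lt hq1
    exact mem_iUnion.2 ⟨⟨q, by exact_mod_cast hq0, hq2⟩, hq1.le⟩
  refine (measure_mono hU).trans ?_
  rw [Directed.measure_iUnion]
  · refine iSup_le fun q => (h q q.2.1 q.2.2).trans ?_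
    gcongr
    exact Metric.closedBall_subset_ball q.2.2
  · apply Monotone.directed_le
    intro a b hab
    exact Metric.closedBall_subset_closedBall (by exact_mod_cast hab)

/-- If `n ⟂ p`, then on a set of at least half the mass of `p` the small balls have `n`-measure
uniformly negligible with respect to their `p`-measure. -/
lemma exists_ball_domination {d : ℕ} {p n : Measure (Space d)} [IsFiniteMeasure p]
    [IsFiniteMeasure n] (hpn : n.MutuallySingular p) (hp : p ≠ 0) {ε : ℝ≥0∞} (hε : 0 < ε)
    (hε' : ε ≠ ∞) :
    ∃ A : Set (Space d), MeasurableSet A ∧ p univ / 2 ≤ p A ∧ ∃ r₀ : ℝ, 0 < r₀ ∧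
      ∀ x ∈ A, ∀ r ≤ r₀, n (Metric.ball x r) ≤ ε * p (Metric.ball x r) := by
  set A : ℕ → Set (Space d) := fun k => {x | ∀ q : ℚ, 0 < q → (q : ℝ) < 1 / ((k : ℝ) + 1) →
    n (Metric.closedBall x q) ≤ ε * p (Metric.closedBall x q)} with hA
  have hAm : ∀ k, MeasurableSet (A k) := fun k => by
    simp only [hA, ofPred_forall]
    refine MeasurableSet.iInter fun q => MeasurableSet.iInter fun _ => MeasurableSet.iInter fun _ => ?_
    exact measurableSet_le (measurable_measure_closedBall n q)
      ((measurable_measure_closedBall p q).const_mul ε)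
  have hmono : Monotone A := by
    intro j k hjk x hx q hq hqk
    refine hx q hq (hqk.trans_le ?_)
    exact one_div_le_one_div_of_le (by positivity) (by gcongr)
  -- Besicovitch differentiation: p-almost everywhere n(B)/p(B) tends to dn/dp, which is 0 as n ⟂ p.
  have hfull : ∀ᵐ x ∂p, x ∈ ⋃ k, A k := by
    have : n.HaveLebesgueDecomposition p := Measure.haveLebesgueDecomposition_of_sigmaFinite n p
    have hr : n.rnDeriv p =ᵐ[p] 0 := (Measure.rnDeriv_eq_zero n p).2 hpn
    filter_upwards [Besicovitch.ae_tendsto_rnDeriv n p, hr] with x hx hx0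
    rw [hx0] at hx
    have h1 := hx.eventually (gt_mem_nhds hε)
    obtain ⟨δ, hδ, h2⟩ := mem_nhdsGT_iff_exists_Ioo_subset.1 h1
    obtain ⟨k, hk⟩ := exists_nat_one_div_lt (show (0 : ℝ) < δ from hδ)
    refine mem_iUnion.2 ⟨k, fun q hq hqk => ?_⟩
    have h3 : n (Metric.closedBall x q) / p (Metric.closedBall x q) < ε :=
      h2 ⟨by exact_mod_cast hq, hqk.trans hk⟩
    -- Finiteness of ε covers balls with p(B) = 0: the quotient would be ∞ unless n(B) = 0 too.
    exact (ENNReal.div_le_iff_le_mul (Or.inr hε') (Or.inl (measure_ne_top _ _))).1 h3.le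
  have hlim := tendsto_measure_iUnion_atTop (μ := p) hmono
  rw [measure_eq_measure_of_null_sdiff (subset_univ _)
    (by rw [← compl_eq_univ_sdiff]; exact hfull)] at hlim
  have hhalf : p univ / 2 < p univ :=
    ENNReal.half_lt_self (by simpa using hp) (measure_ne_top _ _)
  obtain ⟨k, hk⟩ := (hlim.eventually (lt_mem_nhds hhalf)).exists
  refine ⟨A k, hAm k, hk.le, 1 / ((k : ℝ) + 1), by positivity, fun x hx r hr => ?_⟩
  exact measure_ball_le fun q hq hqr => hx q hq (hqr.trans_le hr)

/-! ### From balls to the heat kernel, and positivity of the dissipation. -/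

/-- Gives the radius of the superlevel ball. If a is at least the maximum, `Real.sqrt` has a
nonpositive argument and returns 0, the radius of the empty ball. -/
lemma gaussProfile_lt_iff {d : ℕ} {t a r : ℝ} (ht : 0 < t) (ha : 0 < a) (hr : 0 ≤ r) :
    a < gaussProfile d t r ↔
      r < Real.sqrt (-(4 * t * Real.log (a * (4 * Real.pi * t) ^ ((d : ℝ) / 2)))) := by
  have hK : 0 < (4 * Real.pi * t) ^ ((d : ℝ) / 2) := by positivity
  rw [Real.lt_sqrt hr, gaussProfile, one_div_mul_eq_div, lt_div_iff₀ hK,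
    ← Real.log_lt_iff_lt_exp (by positivity), lt_div_iff₀ (by positivity)]
  constructor <;> intro h <;> linarith

/-- Layer cake for the kernel truncated below at its value at distance r₀: superlevel sets at
positive heights are balls around x of radius at most r₀, where n ≤ ε p. The truncation costs at
most its level times the mass of n. -/
lemma lintegral_heatKernel_le {d : ℕ} {p n : Measure (Space d)} [IsFiniteMeasure p]
    [IsFiniteMeasure n] {ε : ℝ≥0∞} (hε : ε ≠ ∞) {x : Space d} {r₀ : ℝ} (hr₀ : 0 < r₀)
    (h : ∀ r ≤ r₀, n (Metric.ball x r) ≤ ε * p (Metric.ball x r)) {t : ℝ} (ht : 0 < t) :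
    ∫⁻ y, ENNReal.ofReal (heatKernel d t (x - y)) ∂n ≤
      ε * ∫⁻ y, ENNReal.ofReal (heatKernel d t (x - y)) ∂p +
        ENNReal.ofReal (gaussProfile d t r₀) * n univ := by
  set f : Space d → ℝ := fun y => max (heatKernel d t (x - y) - gaussProfile d t r₀) 0 with hf
  have hfm : Measurable f := by fun_prop
  have hf0 : ∀ y, 0 ≤ f y := fun y => le_max_right _ _
  have h0 := gaussProfile_pos d ht r₀
  have hlev : ∀ s ∈ Ioi (0 : ℝ), n {y | s < f y} ≤ ε * p {y | s < f y} := by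
    intro s hs
    have hs : 0 < s := hs
    have ha : 0 < s + gaussProfile d t r₀ := by positivity
    set ρ := Real.sqrt (-(4 * t * Real.log ((s + gaussProfile d t r₀) *
      (4 * Real.pi * t) ^ ((d : ℝ) / 2)))) with hρ
    have hset : {y | s < f y} = Metric.ball x ρ := by
      ext y
      rw [mem_ofPred_eq, Metric.mem_ball, dist_comm, dist_eq_norm, hρ,
        ← gaussProfile_lt_iff ht ha (norm_nonneg _), ← heatKernel_eq, hf]
      simp only [lt_max_iff]
      constructor
      · rintro (h | h)
        · linarith
        · linarith
      · intro h; left; linarith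
    rw [hset]
    apply h
    by_contra! hlt
    rw [hρ, ← gaussProfile_lt_iff ht ha hr₀.le] at hlt
    linarith
  have hle : ∫⁻ y, ENNReal.ofReal (f y) ∂n ≤ ε * ∫⁻ y, ENNReal.ofReal (f y) ∂p := by
    rw [lintegral_eq_lintegral_meas_lt n (ae_of_all _ hf0) hfm.aemeasurable,
      lintegral_eq_lintegral_meas_lt p (ae_of_all _ hf0) hfm.aemeasurable,
      ← lintegral_const_mul' _ _ hε]
    exact setLIntegral_mono' measurableSet_Ioi hlev
  calc _ ≤ ∫⁻ y, (ENNReal.ofReal (f y) + ENNReal.ofReal (gaussProfile d t r₀)) ∂n := by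
        refine lintegral_mono fun y => ?_
        rw [← ENNReal.ofReal_add (hf0 y) h0.le]
        apply ENNReal.ofReal_le_ofReal
        have := le_max_left (heatKernel d t (x - y) - gaussProfile d t r₀) 0
        simp only [hf]
        linarith
    _ = ∫⁻ y, ENNReal.ofReal (f y) ∂n + ENNReal.ofReal (gaussProfile d t r₀) * n univ := by
        rw [lintegral_add_right _ measurable_const, lintegral_const]
    _ ≤ _ := by
        gcongr
        refine hle.trans ?_
        gcongr with y
        simp only [hf]
        exact max_le (by linarith) (heatKernel_pos ht _).le

lemma heatForm_le_two_mul {d : ℕ} {α β : Measure (Space d)} [IsFiniteMeasure α] [IsFiniteMeasure β]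
    {t : ℝ} (ht : 0 < t) :
    heatForm d α β t ≤ 2 ^ ((d : ℝ) / 2) * heatForm d α β (2 * t) := by
  have ht2 : 0 < 2 * t := by positivity
  rw [heatForm_eq_integral ht, heatForm_eq_integral ht2, ← integral_const_mul]
  exact integral_mono (integrable_heatKernel_sub ht) ((integrable_heatKernel_sub ht2).const_mul _)
    fun p => heatKernel_le_two_mul ht _

/-- Some point has only neighbourhoods of positive mass; the square of its ball of radius r/2 lies
in the set. -/
lemma measureReal_near_diagonal_pos {d : ℕ} {α : Measure (Space d)} [IsFiniteMeasure α] (hα : α ≠ 0)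
    {r : ℝ} (hr : 0 < r) : 0 < (α.prod α).real {p | ‖p.1 - p.2‖ ≤ r} := by
  obtain ⟨x, -, hx⟩ := exists_mem_forall_mem_nhdsWithin_pos_measure (μ := α) (s := univ)
    (by simpa using hα)
  have hb := hx (Metric.ball x (r / 2)) (by
    rw [nhdsWithin_univ]; exact Metric.ball_mem_nhds x (half_pos hr))
  have hsub : Metric.ball x (r / 2) ×ˢ Metric.ball x (r / 2) ⊆
      {p : Space d × Space d | ‖p.1 - p.2‖ ≤ r} := by
    rintro ⟨y, z⟩ ⟨hy, hz⟩
    rw [Metric.mem_ball] at hy hz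
    rw [mem_ofPred_eq, ← dist_eq_norm]
    have := dist_triangle_right y z x
    linarith
  rw [Measure.real, ENNReal.toReal_pos_iff]
  refine ⟨?_, measure_lt_top _ _⟩
  refine lt_of_lt_of_le ?_ (measure_mono hsub)
  rw [Measure.prod_prod]
  exact ENNReal.mul_pos hb.ne' hb.ne'

lemma mul_measureReal_le_heatForm {d : ℕ} {α : Measure (Space d)} [IsFiniteMeasure α]
    {t r : ℝ} (ht : 0 < t) :
    gaussProfile d t r * (α.prod α).real {p | ‖p.1 - p.2‖ ≤ r} ≤ heatForm d α α t := by
  have hm : MeasurableSet {p : Space d × Space d | ‖p.1 - p.2‖ ≤ r} :=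
    measurableSet_le (by fun_prop) measurable_const
  rw [heatForm_eq_integral ht, mul_comm, ← smul_eq_mul, ← integral_indicator_const _ hm]
  refine integral_mono ((integrable_const _).indicator hm) (integrable_heatKernel_sub ht) fun p => ?_
  by_cases hp : p ∈ {p : Space d × Space d | ‖p.1 - p.2‖ ≤ r}
  · rw [indicator_of_mem hp]
    exact gaussProfile_anti d ht (norm_nonneg _) hp
  · rw [indicator_of_notMem hp]
    exact (heatKernel_pos ht _).le

/-- The factor exp(-r²/(8t)) is what makes the tail at time t negligible against the self-pairing at
time 2t. -/
lemma gaussProfile_eq_two_mul {d : ℕ} {t : ℝ} (ht : 0 < t) (r : ℝ) :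
    gaussProfile d t r =
      2 ^ ((d : ℝ) / 2) * Real.exp (-(r ^ 2 / 8) * t⁻¹) * gaussProfile d (2 * t) r := by
  unfold gaussProfile
  rw [show 4 * Real.pi * (2 * t) = 2 * (4 * Real.pi * t) by ring,
    Real.mul_rpow (x := 2) (by norm_num) (by positivity),
    show -r ^ 2 / (4 * t) = -(r ^ 2 / 8) * t⁻¹ + -r ^ 2 / (4 * (2 * t)) by field_simp; ring, Real.exp_add]
  have p1 : 0 < (4 * Real.pi * t) ^ ((d : ℝ) / 2) := by positivity
  generalize (4 * Real.pi * t) ^ ((d : ℝ) / 2) = a at *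
  field_simp

/-- Diffusing a suitable half of `p` dissipates the interaction energy of `p - n` for small
times. -/
lemma exists_dissipation {d : ℕ} {p n : Measure (Space d)} [IsFiniteMeasure p]
    [IsFiniteMeasure n] (hpn : n.MutuallySingular p) (hp : p ≠ 0) :
    ∃ A : Set (Space d), MeasurableSet A ∧ p univ / 2 ≤ p A ∧ ∃ t₀ : ℝ, 0 < t₀ ∧
      ∀ t ∈ Ioo 0 t₀, 0 < heatForm d (p.restrict A) p t - heatForm d (p.restrict A) n t +
        heatForm d (p.restrict A) (p.restrict A) (2 * t) -
          heatForm d (p.restrict A) (p.restrict A) t := by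
  -- Chosen so that ε 2^{d/2} = 1/2: the loss ε H(α, α; t) uses at most half of H(α, α; 2t).
  set ε : ℝ := (2 * 2 ^ ((d : ℝ) / 2))⁻¹ with hε
  have hε0 : 0 < ε := by positivity
  have h2 : (1 : ℝ) ≤ 2 ^ ((d : ℝ) / 2) := Real.one_le_rpow (by norm_num) (by positivity)
  have hε1 : ε ≤ 1 := inv_le_one_of_one_le₀ (by linarith)
  obtain ⟨A, hA, hhalf, r₀, hr₀, hball⟩ :=
    exists_ball_domination hpn hp (ENNReal.ofReal_pos.2 hε0) ENNReal.ofReal_ne_top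
  refine ⟨A, hA, hhalf, ?_⟩
  set α := p.restrict A with hα
  have hα0 : α ≠ 0 := by
    rw [hα, Ne, Measure.restrict_eq_zero]
    intro h
    rw [h, nonpos_iff_eq_zero, ENNReal.div_eq_zero_iff] at hhalf
    rcases hhalf with h | h
    · exact hp (by simpa using h)
    · norm_num at h
  set m := (α.prod α).real {q | ‖q.1 - q.2‖ ≤ r₀} with hm
  have hm0 : 0 < m := measureReal_near_diagonal_pos hα0 hr₀
  set D := n.real univ * α.real univ with hD
  have hlim : Filter.Tendsto (fun t : ℝ => 2 ^ ((d : ℝ) / 2) * Real.exp (-(r₀ ^ 2 / 8) * t⁻¹) * D)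
      (nhdsWithin 0 (Ioi 0)) (nhds (2 ^ ((d : ℝ) / 2) * 0 * D)) := by
    refine Filter.Tendsto.mul_const _ (Filter.Tendsto.const_mul _ ?_)
    refine Real.tendsto_exp_atBot.comp ?_
    exact tendsto_inv_nhdsGT_zero.const_mul_atTop_of_neg (by have := sq_pos_of_pos hr₀; linarith)
  rw [mul_zero, zero_mul] at hlim
  obtain ⟨t₀, ht₀, hsmall⟩ := mem_nhdsGT_iff_exists_Ioo_subset.1
    (hlim.eventually (gt_mem_nhds (half_pos hm0)))
  refine ⟨t₀, ht₀, fun t ht => ?_⟩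
  have ht0 : 0 < t := ht.1
  have ht2 : 0 < 2 * t := by positivity
  have hs : 2 ^ ((d : ℝ) / 2) * Real.exp (-(r₀ ^ 2 / 8) * t⁻¹) * D < m / 2 := hsmall ht
  have hk := gaussProfile_pos d ht2 r₀
  have e1 : heatForm d α n t ≤ ε * heatForm d α p t + gaussProfile d t r₀ * D := by
    have h : heatPairing d t α n ≤ ENNReal.ofReal ε * heatPairing d t α p +
        ENNReal.ofReal (gaussProfile d t r₀) * n univ * α univ := by
      unfold heatPairing
      rw [← lintegral_const_mul' _ _ ENNReal.ofReal_ne_top, ← lintegral_const,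
        ← lintegral_add_right _ measurable_const]
      refine lintegral_mono_ae ((ae_restrict_iff' hA).2 (ae_of_all _ fun x hx => ?_))
      exact lintegral_heatKernel_le ENNReal.ofReal_ne_top hr₀ (hball x hx) ht0
    have h3 := (heatPairing_lt_top (α := α) (β := p) ht0).ne
    refine (ENNReal.toReal_mono (by finiteness) h).trans_eq ?_
    rw [ENNReal.toReal_add (by finiteness) (by finiteness), ENNReal.toReal_mul, ENNReal.toReal_mul,
      ENNReal.toReal_mul, ENNReal.toReal_ofReal hε0.le,
      ENNReal.toReal_ofReal (gaussProfile_pos d ht0 _).le, mul_assoc]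
    rfl
  have e2 : heatForm d α α t ≤ heatForm d α p t :=
    ENNReal.toReal_mono (heatPairing_lt_top ht0).ne (heatPairing_mono t le_rfl Measure.restrict_le_self)
  have e3 : ε * heatForm d α α t ≤ heatForm d α α (2 * t) / 2 := by
    calc _ ≤ ε * (2 ^ ((d : ℝ) / 2) * heatForm d α α (2 * t)) := by
          gcongr; exact heatForm_le_two_mul ht0
      _ = _ := by rw [hε]; field_simp
  have e4 := mul_measureReal_le_heatForm (α := α) (r := r₀) ht2
  have e5 : gaussProfile d t r₀ * D < gaussProfile d (2 * t) r₀ * m / 2 := by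
    rw [gaussProfile_eq_two_mul ht0]
    nlinarith
  have e6 : (1 - ε) * heatForm d α α t ≤ (1 - ε) * heatForm d α p t := by
    have : 0 ≤ 1 - ε := by linarith
    gcongr
  -- By `e1` and `e6` the quantity is at least H(α, α; 2t) - ε H(α, α; t) minus the tail. By `e3`
  -- half of H(α, α; 2t) remains, which exceeds the tail strictly by `e4` and `e5`.
  linarith

/-! ### Wasserstein modulus and second moment along the flow. -/

section curve

variable {d : ℕ} {b α : Measure (Space d)} [IsFiniteMeasure α]

/-- Moving the mass of `α` along the heat flow is `1/2`-Hölder for the Wasserstein distance. -/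
lemma W₂_add_heatFlow_le {s t : ℝ} (hs : 0 ≤ s) (ht : 0 ≤ t) :
    W₂ (b + heatFlow s α) (b + heatFlow t α) ≤
      ((∫⁻ z, ‖z‖ₑ ^ 2 ∂heatMeasure d 1) * α univ) ^ (1 / 2 : ℝ) *
        ENNReal.ofReal (Real.sqrt |s - t|) := by
  -- The mass of b stays put, and a point x of α goes to √s z + x and √t z + x with a common
  -- Gaussian z; the displacement is (√s - √t) z.
  set γ : Measure (Space d × Space d) := b.map (fun x => (x, x)) +
    ((heatMeasure d 1).prod α).map
      (fun p => (Real.sqrt s • p.1 + p.2, Real.sqrt t • p.1 + p.2)) with hγ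
  have h1 : γ.map Prod.fst = b + heatFlow s α := by
    rw [hγ, Measure.map_add _ _ measurable_fst, Measure.map_map measurable_fst (by fun_prop),
      Measure.map_map measurable_fst (by fun_prop), heatFlow_eq_map hs]
    congr 1
    exact Measure.map_id
  have h2 : γ.map Prod.snd = b + heatFlow t α := by
    rw [hγ, Measure.map_add _ _ measurable_snd, Measure.map_map measurable_snd (by fun_prop),
      Measure.map_map measurable_snd (by fun_prop), heatFlow_eq_map ht]
    congr 1
    exact Measure.map_id
  have hsq : ‖Real.sqrt s - Real.sqrt t‖ₑ ^ 2 ≤ ENNReal.ofReal |s - t| := by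
    rw [← ofReal_norm, ← ENNReal.ofReal_pow (norm_nonneg _)]
    apply ENNReal.ofReal_le_ofReal
    have e : |s - t| = |Real.sqrt s - Real.sqrt t| * (Real.sqrt s + Real.sqrt t) := by
      rw [← abs_of_nonneg (add_nonneg (Real.sqrt_nonneg s) (Real.sqrt_nonneg t)), ← abs_mul]
      congr 1
      nlinarith [Real.sq_sqrt hs, Real.sq_sqrt ht]
    rw [e, sq, Real.norm_eq_abs]
    gcongr
    have := Real.sqrt_nonneg s
    have := Real.sqrt_nonneg t
    rw [abs_le]; constructor <;> linarith
  have hcost : ∫⁻ p, edist p.1 p.2 ^ 2 ∂γ ≤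
      ((∫⁻ z, ‖z‖ₑ ^ 2 ∂heatMeasure d 1) * α univ) * ENNReal.ofReal |s - t| := by
    rw [hγ, lintegral_add_measure, lintegral_map (by fun_prop) (by fun_prop),
      lintegral_map (by fun_prop) (by fun_prop)]
    simp only [edist_self, ne_eq, OfNat.ofNat_ne_zero, not_false_eq_true, zero_pow, lintegral_zero,
      zero_add]
    have h3 : ∀ p : Space d × Space d, edist (Real.sqrt s • p.1 + p.2) (Real.sqrt t • p.1 + p.2) ^ 2 =
        ‖Real.sqrt s - Real.sqrt t‖ₑ ^ 2 * ‖p.1‖ₑ ^ 2 := fun p => by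
      rw [edist_add_right, edist_eq_enorm_sub, ← sub_smul, enorm_smul, mul_pow]
    simp_rw [h3]
    rw [lintegral_const_mul _ (by fun_prop), lintegral_prod _ (by fun_prop), mul_comm]
    simp only [lintegral_const]
    rw [lintegral_mul_const _ (by fun_prop)]
    gcongr
  unfold W₂
  calc _ ≤ (((∫⁻ z, ‖z‖ₑ ^ 2 ∂heatMeasure d 1) * α univ) * ENNReal.ofReal |s - t|) ^ (1 / 2 : ℝ) := by
        gcongr
        exact (iInf₂_le γ ⟨h1, h2⟩).trans hcost
    _ = _ := by
        rw [ENNReal.mul_rpow_of_nonneg _ _ (by norm_num),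
          ENNReal.ofReal_rpow_of_nonneg (abs_nonneg _) (by norm_num), Real.sqrt_eq_rpow]

lemma hasFiniteSecondMoment_add_heatFlow {t : ℝ} (ht : 0 ≤ t)
    (h : HasFiniteSecondMoment (b + α)) : HasFiniteSecondMoment (b + heatFlow t α) := by
  unfold HasFiniteSecondMoment at h ⊢
  rw [lintegral_add_measure] at h ⊢
  obtain ⟨hb, hα⟩ := ENNReal.add_lt_top.1 h
  refine ENNReal.add_lt_top.2 ⟨hb, ?_⟩
  rw [heatFlow_eq_map ht, lintegral_map (by fun_prop) (by fun_prop)]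
  have h1 : ∀ p : Space d × Space d, ‖Real.sqrt t • p.1 + p.2‖ₑ ^ 2 ≤
      4 * (‖Real.sqrt t‖ₑ ^ 2 * ‖p.1‖ₑ ^ 2 + ‖p.2‖ₑ ^ 2) := fun p => by
    rw [← mul_pow, ← enorm_smul]
    refine (pow_le_pow_left' (enorm_add_le _ _) 2).trans ?_
    rcases le_total ‖Real.sqrt t • p.1‖ₑ ‖p.2‖ₑ with h | h
    · calc _ ≤ (‖p.2‖ₑ + ‖p.2‖ₑ) ^ 2 := by gcongr
        _ = 4 * ‖p.2‖ₑ ^ 2 := by ring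
        _ ≤ _ := by gcongr; exact le_add_self
    · calc _ ≤ (‖Real.sqrt t • p.1‖ₑ + ‖Real.sqrt t • p.1‖ₑ) ^ 2 := by gcongr
        _ = 4 * ‖Real.sqrt t • p.1‖ₑ ^ 2 := by ring
        _ ≤ _ := by gcongr; exact le_self_add
  refine (lintegral_mono h1).trans_lt ?_
  rw [lintegral_const_mul _ (by fun_prop), lintegral_prod _ (by fun_prop)]
  simp_rw [lintegral_add_left measurable_const]
  rw [lintegral_add_right _ measurable_const]
  simp only [lintegral_const]
  rw [lintegral_mul_const _ (by fun_prop), lintegral_const_mul _ (by fun_prop),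
    measure_univ (μ := heatMeasure d 1), mul_one]
  exact ENNReal.mul_lt_top (by norm_num) (ENNReal.add_lt_top.2 ⟨ENNReal.mul_lt_top
    (ENNReal.mul_lt_top (by simp) (lintegral_sq_heatMeasure_lt_top d)) (measure_lt_top _ _), hα⟩)

end curve

/-! ### The energy along the curve and its derivative. -/

/-- The energy dissipated along `b + K_t ⋆ α` relative to `ν`, divided by the kernel constant. -/
def dissipated (d : ℕ) (b α ν : Measure (Space d)) (t : ℝ) : ℝ :=
  (∫ s in (0 : ℝ)..t, heatForm d α b s) - (∫ s in (0 : ℝ)..t, heatForm d α ν s) +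
    (∫ s in (0 : ℝ)..2 * t, heatForm d α α s) / 2

section dissipation

variable {d : ℕ} {b α ν : Measure (Space d)}

/-- The flow is removed from one slot at a time. While the other slot still diffuses, the loss is an
integral over [t, 2t]; the second removal adds [0, t]. -/
lemma IsTame.mutualEnergy_heatFlow_self (hd : 1 ≤ d) (hα : IsTame α) {t : ℝ} (ht : 0 ≤ t) :
    mutualEnergy (coulombKernel d) (CoulombMMD.heatFlow t α) (CoulombMMD.heatFlow t α) =
      mutualEnergy (coulombKernel d) α α -
        (sphereConst d)⁻¹ * ∫ s in (0 : ℝ)..2 * t, heatForm d α α s := by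
  have := hα.finite
  have hK := hα.heatFlow hd ht
  have := hK.finite
  rcases ht.eq_or_lt with rfl | ht'
  · simp [CoulombMMD.heatFlow]
  rw [hα.mutualEnergy_heatFlow hd hK ht, mutualEnergy_comm, hα.mutualEnergy_heatFlow hd hα ht]
  have h1 : ∫ s in (0 : ℝ)..t, heatForm d α (CoulombMMD.heatFlow t α) s =
      ∫ s in t..2 * t, heatForm d α α s := by
    have h2 := intervalIntegral.integral_comp_add_right (a := 0) (b := t) (heatForm d α α) t
    rw [zero_add, ← two_mul] at h2
    rw [← h2]
    apply intervalIntegral.integral_congr_ae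
    refine ae_of_all _ fun s hs => ?_
    rw [uIoc_of_le ht] at hs
    rw [← heatForm_heatFlow hs.1 ht']
    unfold heatForm
    rw [heatPairing_comm]
  have h3 := intervalIntegral.integral_add_adjacent_intervals
    (hα.intervalIntegrable_heatForm hα le_rfl ht)
    (hα.intervalIntegrable_heatForm hα ht (by linarith : 0 ≤ 2 * t))
  rw [h1, ← h3]
  ring

lemma energy_add_heatFlow (hd : 1 ≤ d) (hb : IsTame b) (hα : IsTame α) (hν : IsTame ν)
    [IsFiniteMeasure ν] {t : ℝ} (ht : 0 ≤ t) [IsFiniteMeasure (b + heatFlow t α)] :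
    energy (coulombKernel d) ((b + heatFlow t α).toSignedMeasure - ν.toSignedMeasure) =
      (mutualEnergy (coulombKernel d) (b + α) (b + α) - 2 * mutualEnergy (coulombKernel d) (b + α) ν +
        mutualEnergy (coulombKernel d) ν ν) / 2 - (sphereConst d)⁻¹ * dissipated d b α ν t := by
  have := hα.finite
  have := hb.finite
  have hK := hα.heatFlow hd ht
  have := hK.finite
  have hbK := hb.add hK
  have hbα := hb.add hα
  rw [energy_sub hd hbK hν, mutualEnergy_add_left hd hb hK hbK, mutualEnergy_add_right hd hb hK hb,
    mutualEnergy_add_right hd hb hK hK, mutualEnergy_add_left hd hb hK hν,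
    mutualEnergy_add_left hd hb hα hbα, mutualEnergy_add_right hd hb hα hb,
    mutualEnergy_add_right hd hb hα hα, mutualEnergy_add_left hd hb hα hν,
    mutualEnergy_comm (α := b) (β := CoulombMMD.heatFlow t α), mutualEnergy_comm (α := b) (β := α),
    hα.mutualEnergy_heatFlow hd hb ht, hα.mutualEnergy_heatFlow hd hν ht,
    hα.mutualEnergy_heatFlow_self hd ht, dissipated]
  ring

lemma hasDerivAt_integral_heatForm {β : Measure (Space d)} (hα : IsTame α) (hβ : IsTame β) {t : ℝ}
    (ht : 0 < t) :
    HasDerivAt (fun t => ∫ s in (0 : ℝ)..t, heatForm d α β s) (heatForm d α β t) t := by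
  have := hα.finite
  have := hβ.finite
  exact intervalIntegral.integral_hasDerivAt_right
    (hα.intervalIntegrable_heatForm hβ le_rfl ht.le)
    measurable_heatForm.stronglyMeasurable.stronglyMeasurableAtFilter
    (continuousOn_heatForm.continuousAt (Ioi_mem_nhds ht))

/-- The heat form may blow up at time 0 but is integrable there. Continuity up to 0 brings the
starting point into the strict decrease. -/
lemma continuousOn_integral_heatForm {β : Measure (Space d)} (hα : IsTame α) (hβ : IsTame β) :
    ContinuousOn (fun t => ∫ s in (0 : ℝ)..t, heatForm d α β s) (Ici 0) := by
  intro t ht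
  have ht : 0 ≤ t := ht
  have h := intervalIntegral.continuousOn_primitive_interval (a := 0) (b := t + 1)
    (f := heatForm d α β) (μ := volume) (by
      rw [uIcc_of_le (by linarith), integrableOn_Icc_iff_integrableOn_Ioc]
      exact hα.integrableOn_heatForm hβ _)
  rw [uIcc_of_le (by linarith)] at h
  refine (h t ⟨ht, by linarith⟩).mono_of_mem_nhdsWithin ?_
  rw [mem_nhdsWithin_iff_exists_mem_nhds_inter]
  exact ⟨Iio (t + 1), Iio_mem_nhds (by linarith), fun x hx => ⟨hx.2, hx.1.le⟩⟩

lemma hasDerivAt_dissipated (hb : IsTame b) (hα : IsTame α) (hν : IsTame ν) {t : ℝ} (ht : 0 < t) :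
    HasDerivAt (dissipated d b α ν)
      (heatForm d α b t - heatForm d α ν t + heatForm d α α (2 * t)) t := by
  have h2 : HasDerivAt (fun t : ℝ => 2 * t) 2 t := by simpa using (hasDerivAt_id t).const_mul 2
  have h3 := (hasDerivAt_integral_heatForm hα hα (show 0 < 2 * t by positivity)).comp t h2
  refine (((hasDerivAt_integral_heatForm hα hb ht).sub
    (hasDerivAt_integral_heatForm hα hν ht)).add (h3.div_const 2)).congr_deriv ?_
  ring

lemma continuousOn_dissipated (hb : IsTame b) (hα : IsTame α) (hν : IsTame ν) :
    ContinuousOn (dissipated d b α ν) (Ici 0) := by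
  refine ((continuousOn_integral_heatForm hα hb).sub (continuousOn_integral_heatForm hα hν)).add
    (ContinuousOn.div_const ?_ 2)
  refine (continuousOn_integral_heatForm hα hα).comp (f := fun t : ℝ => 2 * t) (by fun_prop) ?_
  intro t ht
  have ht : 0 ≤ t := ht
  exact mem_Ici.2 (by positivity)

end dissipation

/-! ### The descent curve and the absence of other local minima. -/

/-- The curve `t ↦ b + K_t ⋆ α`, stopped at negative times. -/
def diffusionCurve {d : ℕ} (b α : Measure (Space d)) [IsFiniteMeasure α]
    (h : IsProbabilityMeasure (b + α)) (t : ℝ) : ProbabilityMeasure (Space d) :=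
  ⟨b + heatFlow (max t 0) α, ⟨by
    rw [Measure.add_apply, heatFlow_univ (le_max_right _ _), ← Measure.add_apply, measure_univ]⟩⟩

lemma heatForm_add_right {d : ℕ} {α x y : Measure (Space d)} [IsFiniteMeasure α] [IsFiniteMeasure x]
    [IsFiniteMeasure y] {t : ℝ} (ht : 0 < t) :
    heatForm d α (x + y) t = heatForm d α x t + heatForm d α y t := by
  unfold heatForm
  rw [heatPairing_comm, heatPairing_add_left, ENNReal.toReal_add (heatPairing_lt_top ht).ne
    (heatPairing_lt_top ht).ne, heatPairing_comm, heatPairing_comm (α := y)]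

lemma discrepancy_eq_of_coe_eq {d : ℕ} {b α : Measure (Space d)}
    {ν : ProbabilityMeasure (Space d)} (hd : 1 ≤ d) (tb : IsTame b) (tα : IsTame α)
    (tν : IsTame (ν : Measure (Space d))) {m : ProbabilityMeasure (Space d)} {t : ℝ} (ht : 0 ≤ t)
    (hm : (m : Measure (Space d)) = b + heatFlow t α) :
    discrepancy (coulombKernel d) ν m =
      (mutualEnergy (coulombKernel d) (b + α) (b + α) -
        2 * mutualEnergy (coulombKernel d) (b + α) ν + mutualEnergy (coulombKernel d) ν ν) / 2 -
        (sphereConst d)⁻¹ * dissipated d b α ν t := by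
  have hfin : IsFiniteMeasure (b + heatFlow t α) := by rw [← hm]; infer_instance
  rw [← energy_add_heatFlow hd tb tα tν ht]
  unfold discrepancy signedDiff
  simp only [hm]

section diffusionCurve

variable {d : ℕ} {b α : Measure (Space d)} [IsFiniteMeasure α]

lemma coe_diffusionCurve (h : IsProbabilityMeasure (b + α)) {t : ℝ} (ht : 0 ≤ t) :
    (diffusionCurve b α h t : Measure (Space d)) = b + heatFlow t α := by
  change b + heatFlow (max t 0) α = _
  rw [max_eq_left ht]

lemma isHalfHolder_diffusionCurve (h : IsProbabilityMeasure (b + α)) :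
    IsHalfHolder (diffusionCurve b α h) := by
  have hfin : ((∫⁻ z, ‖z‖ₑ ^ 2 ∂heatMeasure d 1) * α univ) ^ (1 / 2 : ℝ) ≠ ∞ :=
    ENNReal.rpow_ne_top_of_nonneg (by norm_num)
      (ENNReal.mul_lt_top (lintegral_sq_heatMeasure_lt_top d) (measure_lt_top _ _)).ne
  refine ⟨(((∫⁻ z, ‖z‖ₑ ^ 2 ∂heatMeasure d 1) * α univ) ^ (1 / 2 : ℝ)).toNNReal, fun s t hs ht => ?_⟩
  rw [ENNReal.coe_toNNReal hfin, coe_diffusionCurve h hs, coe_diffusionCurve h ht]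
  exact W₂_add_heatFlow_le hs ht

variable {ν : ProbabilityMeasure (Space d)}

lemma hasFiniteEnergy_diffusionCurve (hd : 1 ≤ d) (tb : IsTame b) (tα : IsTame α)
    (tν : IsTame (ν : Measure (Space d))) (h : IsProbabilityMeasure (b + α)) {t : ℝ} (ht : 0 ≤ t) :
    HasFiniteEnergy (coulombKernel d) (diffusionCurve b α h t : Measure (Space d)) ∧
      HasFiniteEnergy (coulombKernel d) (signedDiff (diffusionCurve b α h t) ν).totalVariation := by
  have tc : IsTame (diffusionCurve b α h t : Measure (Space d)) := by
    rw [coe_diffusionCurve h ht]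
    exact tb.add (tα.heatFlow hd ht)
  generalize diffusionCurve b α h t = m at tc
  obtain ⟨hp, hn⟩ := jordan_le (jordan_add_eq (m : Measure (Space d)) (ν : Measure (Space d)))
  exact ⟨tc.hasFiniteEnergy hd, ((tc.mono hp).add (tν.mono hn)).hasFiniteEnergy hd⟩

lemma discrepancy_diffusionCurve (hd : 1 ≤ d) (tb : IsTame b) (tα : IsTame α)
    (tν : IsTame (ν : Measure (Space d))) (h : IsProbabilityMeasure (b + α)) {t₀ : ℝ}
    (hpos : ∀ t ∈ Ioo 0 t₀, 0 < heatForm d α b t - heatForm d α ν t + heatForm d α α (2 * t)) :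
    (∀ t ∈ Ioo 0 t₀, ∃ e : ℝ, e < 0 ∧
      HasDerivAt (fun s => discrepancy (coulombKernel d) ν (diffusionCurve b α h s)) e t) ∧
    StrictAntiOn (fun s => discrepancy (coulombKernel d) ν (diffusionCurve b α h s)) (Ico 0 t₀) := by
  obtain ⟨E₀, hE⟩ : ∃ E₀ : ℝ, ∀ t : ℝ, 0 ≤ t →
      discrepancy (coulombKernel d) ν (diffusionCurve b α h t) =
        E₀ - (sphereConst d)⁻¹ * dissipated d b α ν t :=
    ⟨_, fun t ht => discrepancy_eq_of_coe_eq hd tb tα tν ht (coe_diffusionCurve h ht)⟩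
  have hder : ∀ t ∈ Ioo 0 t₀, HasDerivAt (fun s => E₀ - (sphereConst d)⁻¹ * dissipated d b α ν s)
      (-((sphereConst d)⁻¹ * (heatForm d α b t - heatForm d α ν t + heatForm d α α (2 * t)))) t :=
    fun t ht => ((hasDerivAt_dissipated tb tα tν ht.1).const_mul (sphereConst d)⁻¹).const_sub E₀
  have hneg : ∀ t ∈ Ioo 0 t₀, -((sphereConst d)⁻¹ *
      (heatForm d α b t - heatForm d α ν t + heatForm d α α (2 * t))) < 0 := fun t ht =>
    neg_neg_of_pos (mul_pos (inv_pos.2 (sphereConst_pos hd)) (hpos t ht))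
  refine ⟨fun t ht => ⟨_, hneg t ht, ?_⟩, ?_⟩
  · refine (hder t ht).congr_of_eventuallyEq ?_
    filter_upwards [lt_mem_nhds ht.1] with s hs using hE s hs.le
  · have hanti : StrictAntiOn (fun s => E₀ - (sphereConst d)⁻¹ * dissipated d b α ν s) (Ico 0 t₀) := by
      apply strictAntiOn_of_deriv_neg (convex_Ico 0 t₀)
      · exact continuousOn_const.sub (continuousOn_const.mul
          ((continuousOn_dissipated tb tα tν).mono fun x hx => hx.1))
      · intro t ht
        rw [interior_Ico] at ht
        rw [(hder t ht).deriv]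
        exact hneg t ht
    exact hanti.congr fun t ht => (hE t ht.1).symm

end diffusionCurve

/-- Equal total masses: if the positive part vanishes, the negative part has mass 0 and μ = ν. -/
lemma posComponent_ne_zero {X : Type*} [MeasurableSpace X] {μ ν : ProbabilityMeasure X}
    (h : μ ≠ ν) : posComponent μ ν ≠ 0 := by
  intro h0
  have h1 := jordan_add_eq (μ : Measure X) (ν : Measure X)
  change posComponent μ ν + (ν : Measure X) = _ + (μ : Measure X) at h1
  rw [h0, zero_add] at h1
  have h2 := congrArg (fun m : Measure X => m univ) h1
  simp only [Measure.add_apply, measure_univ] at h2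
  have h3 : (signedDiff μ ν).toJordanDecomposition.negPart univ = 0 := by
    have : (0 : ℝ≥0∞) + 1 = (signedDiff μ ν).toJordanDecomposition.negPart univ + 1 := by
      rw [zero_add]; exact h2
    exact ((ENNReal.add_left_inj ENNReal.one_ne_top).1 this).symm
  rw [Measure.measure_univ_eq_zero] at h3
  change _ = (signedDiff μ ν).toJordanDecomposition.negPart + _ at h1
  rw [h3, zero_add] at h1
  exact h (Subtype.ext h1.symm)

/-- The descent curve issued from a measure of finite energy different from the target. -/
theorem exists_descent_curve {d : ℕ} (hd : 1 ≤ d) {ν μ : ProbabilityMeasure (Space d)}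
    (hν : HasFiniteEnergy (coulombKernel d) (ν : Measure (Space d)))
    (hμ : HasFiniteEnergy (coulombKernel d) (μ : Measure (Space d))) (hne : μ ≠ ν) :
    ∃ A : Set (Space d), MeasurableSet A ∧ posComponent μ ν univ / 2 ≤ posComponent μ ν A ∧
      ∃ c : ℝ → ProbabilityMeasure (Space d),
        c 0 = μ ∧
        (∀ t : ℝ, 0 ≤ t → (c t : Measure (Space d)) + (posComponent μ ν).restrict A =
          (μ : Measure (Space d)) + heatFlow t ((posComponent μ ν).restrict A)) ∧
        IsHalfHolder c ∧
        (HasFiniteSecondMoment (μ : Measure (Space d)) →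
          ∀ t : ℝ, 0 ≤ t → HasFiniteSecondMoment (c t : Measure (Space d))) ∧
        (∀ t : ℝ, 0 ≤ t → HasFiniteEnergy (coulombKernel d) (c t : Measure (Space d)) ∧
          HasFiniteEnergy (coulombKernel d) (signedDiff (c t) ν).totalVariation) ∧
        ∃ t₀ : ℝ, 0 < t₀ ∧
          (∀ t ∈ Ioo 0 t₀, ∃ e : ℝ, e < 0 ∧
            HasDerivAt (fun s => discrepancy (coulombKernel d) ν (c s)) e t) ∧
          StrictAntiOn (fun s => discrepancy (coulombKernel d) ν (c s)) (Ico 0 t₀) := by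
  have tν := hν.isTame hd
  have tμ := hμ.isTame hd
  have hj := jordan_add_eq (μ : Measure (Space d)) (ν : Measure (Space d))
  change posComponent μ ν + (ν : Measure (Space d)) =
    (signedDiff μ ν).toJordanDecomposition.negPart + (μ : Measure (Space d)) at hj
  obtain ⟨hpμ, hnν⟩ := jordan_le hj
  change posComponent μ ν ≤ _ at hpμ
  have hsing : (signedDiff μ ν).toJordanDecomposition.negPart.MutuallySingular (posComponent μ ν) :=
    (signedDiff μ ν).toJordanDecomposition.mutuallySingular.symm
  have hp0 := posComponent_ne_zero hne
  generalize posComponent μ ν = p at *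
  generalize (signedDiff μ ν).toJordanDecomposition.negPart = n at *
  have tp := tμ.mono hpμ
  have tn := tν.mono hnν
  have := tp.finite
  have := tn.finite
  obtain ⟨A, hA, hhalf, t₀, ht₀, hdiss⟩ := exists_dissipation hsing hp0
  refine ⟨A, hA, hhalf, ?_⟩
  have hαp : p.restrict A ≤ p := Measure.restrict_le_self
  generalize p.restrict A = α at *
  have tα := tp.mono hαp
  have := tα.finite
  -- The part left in place is a positive measure because α ≤ p ≤ μ.
  obtain ⟨b, hb⟩ : ∃ b : Measure (Space d), b + α = μ :=
    ⟨μ - α, Measure.sub_add_cancel_of_le (hαp.trans hpμ)⟩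
  have hbμ : b ≤ μ := by rw [← hb]; exact Measure.le_add_right le_rfl
  have tb := tμ.mono hbμ
  have := tb.finite
  have hprob : IsProbabilityMeasure (b + α) := by rw [hb]; infer_instance
  have hpos : ∀ t ∈ Ioo 0 t₀, 0 < heatForm d α b t - heatForm d α ν t + heatForm d α α (2 * t) := by
    -- From p + ν = n + μ and b + α = μ, pairing with α gives H(α, b) - H(α, ν) = H(α, p) - H(α, n)
    -- - H(α, α), the expression of `exists_dissipation`.
    intro t ht
    have h1 := congrArg (fun m => heatForm d α m t) hj
    have h2 := congrArg (fun m => heatForm d α m t) hb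
    simp only [heatForm_add_right ht.1] at h1 h2
    have := hdiss t ht
    linarith
  obtain ⟨h1, h2⟩ := discrepancy_diffusionCurve hd tb tα tν hprob hpos
  refine ⟨diffusionCurve b α hprob, ?_, fun t ht => ?_, isHalfHolder_diffusionCurve hprob,
    fun h t ht => ?_, fun t ht => hasFiniteEnergy_diffusionCurve hd tb tα tν hprob ht, t₀, ht₀, h1, h2⟩
  · apply Subtype.ext
    refine (coe_diffusionCurve hprob le_rfl).trans ?_
    rw [heatFlow, if_pos rfl]
    exact hb
  · rw [coe_diffusionCurve hprob ht, ← hb, add_right_comm]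
  · rw [coe_diffusionCurve hprob ht]
    rw [← hb] at h
    exact hasFiniteSecondMoment_add_heatFlow ht h

/-- Otherwise the descent curve from μ stays within C√t of μ and has strictly lower energy at every
small t > 0. -/
theorem eq_of_isWassersteinLocalMin {d : ℕ} (hd : 1 ≤ d) {ν μ : ProbabilityMeasure (Space d)}
    (hν : HasFiniteEnergy (coulombKernel d) (ν : Measure (Space d)))
    (h : IsWassersteinLocalMin d ν μ) : μ = ν := by
  obtain ⟨hμ, ε, hε, hmin⟩ := h
  by_contra hne
  obtain ⟨A, -, -, c, hc0, -, ⟨C, hC⟩, -, hfe, t₀, ht₀, -, hanti⟩ :=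
    exists_descent_curve hd hν hμ hne
  have hcont : Continuous fun t : ℝ => (C : ℝ≥0∞) * ENNReal.ofReal (Real.sqrt |t - 0|) :=
    ENNReal.continuous_const_mul ENNReal.coe_ne_top |>.comp
      (ENNReal.continuous_ofReal.comp (by fun_prop))
  have hlim := (hcont.tendsto 0).eventually (gt_mem_nhds (show _ < ε by simpa using hε))
  obtain ⟨δ, hδ, hsub⟩ := Metric.eventually_nhds_iff.1 hlim
  set t := min (δ / 2) (t₀ / 2) with ht
  have ht0 : 0 < t := lt_min (half_pos hδ) (half_pos ht₀)
  have htδ : t < δ := (min_le_left _ _).trans_lt (half_lt_self hδ)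
  have htt₀ : t < t₀ := (min_le_right _ _).trans_lt (half_lt_self ht₀)
  have hclose : W₂ (c t : Measure (Space d)) (μ : Measure (Space d)) < ε := by
    rw [← hc0]
    refine (hC t 0 ht0.le le_rfl).trans_lt (hsub ?_)
    rwa [Real.dist_eq, sub_zero, abs_of_pos ht0]
  have h1 := hmin (c t) (hfe t ht0.le).1 hclose
  have h2 := hanti (left_mem_Ico.2 ht₀) ⟨ht0.le, htt₀⟩ ht0
  simp only [hc0] at h2
  exact absurd h1 (not_le.2 h2)

end CoulombMMD

end

theorem mainTheorem3 (d : ℕ) (hd : 1 ≤ d)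
    (ν : ProbabilityMeasure (CoulombMMD.Space d))
    (hν : CoulombMMD.HasFiniteEnergy (CoulombMMD.coulombKernel d)
      (ν : Measure (CoulombMMD.Space d))) :
    (∀ μ : ProbabilityMeasure (CoulombMMD.Space d),
      CoulombMMD.HasFiniteEnergy (CoulombMMD.coulombKernel d)
        (μ : Measure (CoulombMMD.Space d)) →
      μ ≠ ν →
      ∃ A : Set (CoulombMMD.Space d), MeasurableSet A ∧
        CoulombMMD.posComponent μ ν Set.univ / 2 ≤ CoulombMMD.posComponent μ ν A ∧
        ∃ c : ℝ → ProbabilityMeasure (CoulombMMD.Space d),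
          c 0 = μ ∧
          -- `c t = μ + K_t ⋆ μ₊|A - μ₊|A`, written without subtraction
          (∀ t : ℝ, 0 ≤ t →
            (c t : Measure (CoulombMMD.Space d)) + (CoulombMMD.posComponent μ ν).restrict A =
              (μ : Measure (CoulombMMD.Space d)) +
                CoulombMMD.heatFlow t ((CoulombMMD.posComponent μ ν).restrict A)) ∧
          CoulombMMD.IsHalfHolder c ∧
          (CoulombMMD.HasFiniteSecondMoment (μ : Measure (CoulombMMD.Space d)) →
            ∀ t : ℝ, 0 ≤ t →
              CoulombMMD.HasFiniteSecondMoment (c t : Measure (CoulombMMD.Space d))) ∧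
          (∀ t : ℝ, 0 ≤ t →
            CoulombMMD.HasFiniteEnergy (CoulombMMD.coulombKernel d)
              (c t : Measure (CoulombMMD.Space d)) ∧
            CoulombMMD.HasFiniteEnergy (CoulombMMD.coulombKernel d)
              (CoulombMMD.signedDiff (c t) ν).totalVariation) ∧
          ∃ t₀ : ℝ, 0 < t₀ ∧
            (∀ t ∈ Set.Ioo 0 t₀, ∃ e : ℝ, e < 0 ∧
              HasDerivAt (fun s => CoulombMMD.discrepancy (CoulombMMD.coulombKernel d) ν (c s))
                e t) ∧
            StrictAntiOn (fun s => CoulombMMD.discrepancy (CoulombMMD.coulombKernel d) ν (c s))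
              (Set.Ico 0 t₀)) ∧
    (∀ μ : ProbabilityMeasure (CoulombMMD.Space d),
      CoulombMMD.IsWassersteinLocalMin d ν μ → μ = ν) :=
  ⟨fun _ hμ hne => CoulombMMD.exists_descent_curve hd hν hμ hne,
    fun _ h => CoulombMMD.eq_of_isWassersteinLocalMin hd hν h⟩
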